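/- **Theorem 3.4 (Outlier-Efficient Hopfield Layer Generalization Bound).** For $z\in\mathbb{R}^M$ let $\mathrm{Softmax}_1(z)_\mu=\exp(z_\mu)/\bigl(1+\sum_{\nu=1}^M\exp(z_\nu)\bigr)$, applied to matrices column by column. For $\beta\in\mathbb{R}$, $Y=[y_1,\dots,y_M]^\top\in\mathbb{R}^{M\times a}$, $Q=[q_1,\dots,q_T]^\top\in\mathbb{R}^{T\times d}$ and $W_K,\tilde W_V\in\mathbb{R}^{a\times d}$ let $$f_{\mathrm{hop}}(Y,Q;W_K,\tilde W_V)=\tilde W_V^{\top}Y^{\top}\,\mathrm{Softmax}_1\bigl(\beta\,Y W_K Q^{\top}\bigr)\in\mathbb{R}^{d\times T},$$ and let $\mathcal F_{\mathrm{hop}}$ be the class of all maps $(Y,Q)\mapsto f_{\mathrm{hop}}(Y,Q;W_K,\tilde W_V)$ with $$\|W_K^\top\|_2\le B_K,\quad \|W_K\|_{2,1}\le B_K^{2,1},\quad \|\tilde W_V^\top\|_2\le B_V,\quad \|\tilde W_V\|_{2,1}\le B_V^{2,1}.$$ Here $\|\cdot\|_2$ is the spectral norm, and $\|A\|_{2,1}$,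 $\|A\|_{2,\infty}$ are the sum and the maximum of the Euclidean norms of the columns of $A$. Let $D$ be a probability distribution of labelled examples $((Y,Q),u)$, where $u$ lies in an arbitrary measurable space $U$, such that almost surely $\|q_\tau\|\le 1$ for all $\tau\in[T]$ and $\|y_t\|\le B_Y$ for all $t\in[M]$. Let $\ell:\mathbb{R}^{d\times T}\times U\to[-b,b]$ be a loss that is measurable in its second argument and $L$-Lipschitz ($L\ge 0$) with respect to $\|\cdot\|_{2,\infty}$ in its first. For an i.i.d. sample $((Y^{(i)},Q^{(i)}),u^{(i)})_{i\le N}$ from $D$ put $$\mathrm{gap}(f)=\mathbb{E}_{D}\,\ell(f(Y,Q),u)-\frac1N\sum_{i=1}^N\ell\bigl(f(Y^{(i)},Q^{(i)}),u^{(i)}\bigr),\qquad \varepsilon_{\mathrm{gen}}(f)=|\mathrm{gap}(f)|,$$ $$E_1=\bigl[4B_V^2B_Y^2(\beta B_K^{2,1})^2\log(dNM)\bigr]^{1/3},\qquad E_2=\bigl[(B_V^{2,1})^2\log(dNM)\bigr]^{1/3}.$$ There is an absolute constant $C>0$ (in particular independent of $T$, of all dimensions, of all norm bounds, and of $D$ and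 $\ell$) such that, whenever $dNM\ge 2$, for every $\delta>0$: 1. with probability at least $1-\delta$, simultaneously for all $f\in\mathcal F_{\mathrm{hop}}$, $$\mathrm{gap}(f)\le C\,N^{-1/2}\Bigl[L\,B_Y\,(1+\log N)\sqrt{(E_1+E_2)^3}+b\sqrt{\log(1/\delta)}\Bigr];$$ 2. with probability at least $1-\delta$, simultaneously for all $f\in\mathcal F_{\mathrm{hop}}$, $$\varepsilon_{\mathrm{gen}}(f)\le C\,N^{-1/2}\Bigl[L\,B_Y\,(1+\log N)\sqrt{(E_1+E_2)^3}+b\sqrt{\log(2/\delta)}\Bigr].$$ (The square root of a negative number is read as $0$; this occurs only where the probability claim is trivial, that is, for $\delta\geq 1$.) -/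

import Mathlib

open MeasureTheory
open scoped Matrix

noncomputable section

namespace OutEffHop

/-- The function `Softmax₁(z)_μ = exp z_μ / (∑_ν exp z_ν + 1)` on `ℝ^M`. -/
def softmax1 {M : ℕ} (z : Fin M → ℝ) (μ : Fin M) : ℝ :=
  Real.exp (z μ) / (∑ ν, Real.exp (z ν) + 1)

/-- `Softmax₁` applied to every column of a matrix (one column for each query vector). -/
def softmax1Cols {M T : ℕ} (Z : Matrix (Fin M) (Fin T) ℝ) : Matrix (Fin M) (Fin T) ℝ :=
  Matrix.of fun μ τ => softmax1 (fun ν => Z ν τ) μ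

/-- The Euclidean norm of a vector given by its coordinates. -/
def l2Norm {n : ℕ} (v : Fin n → ℝ) : ℝ := ‖(WithLp.toLp 2 v : EuclideanSpace ℝ (Fin n))‖

/-- The `ℓ₂` (spectral) norm of a matrix: its operator norm between Euclidean spaces. -/
def specNorm {m n : ℕ} (A : Matrix (Fin m) (Fin n) ℝ) : ℝ :=
  ‖LinearMap.toContinuousLinearMap (Matrix.toEuclideanLin A)‖

/-- `‖A‖_{2,1}`: the sum of the Euclidean norms of the columns of `A`. -/
def norm21 {m n : ℕ} (A : Matrix (Fin m) (Fin n) ℝ) : ℝ := ∑ j, l2Norm fun i => A i j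

/-- `‖A‖_{2,∞}`: the largest Euclidean norm of a column of `A`. -/
def norm2inf {m n : ℕ} (A : Matrix (Fin m) (Fin n) ℝ) : ℝ := ⨆ j, l2Norm fun i => A i j

/-- Matrices carry the product (equivalently, the Borel) sigma-algebra of their entries. -/
instance matrixMeasurableSpace {m n : ℕ} : MeasurableSpace (Matrix (Fin m) (Fin n) ℝ) :=
  inferInstanceAs (MeasurableSpace (Fin m → Fin n → ℝ))

/-- The inputs `(Y, Q)` of the layer: a memory matrix with rows `y_t ∈ ℝ^a` (`t ∈ [M]`) and
a query matrix with rows `q_τ ∈ ℝ^d` (`τ ∈ [T]`). -/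
abbrev Input (a d M T : ℕ) : Type :=
  Matrix (Fin M) (Fin a) ℝ × Matrix (Fin T) (Fin d) ℝ

/-- The layer `f_hop(Y, Q; W_K, W̃_V) = W̃_Vᵀ Yᵀ Softmax₁(β Y W_K Qᵀ) ∈ ℝ^{d × T}`. -/
def fHop {a d M T : ℕ} (β : ℝ) (WK WV : Matrix (Fin a) (Fin d) ℝ) (x : Input a d M T) :
    Matrix (Fin d) (Fin T) ℝ :=
  WVᵀ * x.1ᵀ * softmax1Cols (β • (x.1 * WK * x.2ᵀ))

/-- A pair of norm constraints on a weight matrix: `‖Wᵀ‖₂ ≤ B` and `‖W‖_{2,1} ≤ B21`. -/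
def weightClass (a d : ℕ) (B B21 : ℝ) : Set (Matrix (Fin a) (Fin d) ℝ) :=
  {W | specNorm Wᵀ ≤ B ∧ norm21 W ≤ B21}

/-- The function class `F_hop`. -/
def hopClass (a d M T : ℕ) (β BK BK21 BV BV21 : ℝ) :
    Set (Input a d M T → Matrix (Fin d) (Fin T) ℝ) :=
  {f | ∃ WK ∈ weightClass a d BK BK21, ∃ WV ∈ weightClass a d BV BV21, f = fHop β WK WV}

/-- Norm bounds on the inputs: every query vector has norm at most `1`, every memory vector has
norm at most `BY`. -/
def InputBounds {a d M T : ℕ} (BY : ℝ) (x : Input a d M T) : Prop :=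
  (∀ τ, l2Norm (x.2 τ) ≤ 1) ∧ ∀ t, l2Norm (x.1 t) ≤ BY

section Risk

variable {X O U : Type*}

/-- The population risk of the predictor `f`, for the loss `ℓ` and the distribution `D` of
labelled examples. -/
def risk [MeasurableSpace X] [MeasurableSpace U] (D : Measure (X × U)) (ℓ : O → U → ℝ)
    (f : X → O) : ℝ :=
  ∫ z, ℓ (f z.1) z.2 ∂D

/-- The empirical risk of `f` on the sample `S` of size `N`. -/
def empRisk {N : ℕ} (ℓ : O → U → ℝ) (f : X → O) (S : Fin N → X × U) : ℝ :=
  (∑ i, ℓ (f (S i).1) (S i).2) / N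

/-- The signed generalization gap: population risk minus empirical risk. -/
def genGap [MeasurableSpace X] [MeasurableSpace U] {N : ℕ} (D : Measure (X × U))
    (ℓ : O → U → ℝ) (f : X → O) (S : Fin N → X × U) : ℝ :=
  risk D ℓ f - empRisk ℓ f S

/-- The generalization error `ε_gen(f)`: the absolute value of the generalization gap. -/
def genError [MeasurableSpace X] [MeasurableSpace U] {N : ℕ} (D : Measure (X × U))
    (ℓ : O → U → ℝ) (f : X → O) (S : Fin N → X × U) : ℝ :=
  |genGap D ℓ f S|

end Risk

/-- `E₁ = [4 B_V² B_Y² (β B_K^{2,1})² log(d N M)]^{1/3}`. -/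
def E1 (d N M : ℕ) (β BY BK21 BV : ℝ) : ℝ :=
  (4 * BV ^ 2 * BY ^ 2 * (β * BK21) ^ 2 * Real.log (d * N * M)) ^ (1 / 3 : ℝ)

/-- `E₂ = [(B_V^{2,1})² log(d N M)]^{1/3}`. -/
def E2 (d N M : ℕ) (BV21 : ℝ) : ℝ :=
  (BV21 ^ 2 * Real.log (d * N * M)) ^ (1 / 3 : ℝ)

end OutEffHop

end

/-!
The bound is the classical chain covering numbers → chaining → symmetrization → concentration; the
work is in a covering bound which is free of `T`, of the dimension `a`, and of any logarithm of the
radius.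

*Covering.* A column of the output is `∑ t, s_t • W̃_Vᵀ y_t`, where `s` is `Softmax₁` of the numbers
`β ⟪W_Kᵀ y_t, q⟫`. Because `‖q‖ ≤ 1` and `Softmax₁` is Lipschitz from `ℓ_∞` to `ℓ₁`
(`sum_abs_softmax1_sub_le`), it is enough to approximate the vectors `W_Kᵀ y_t` and `W̃_Vᵀ y_t` at the
memory vectors of the sample (`norm2inf_fHop_sub_le`); the queries play no role, so `T` disappears.
For this, `exists_greedy_cover` runs a perceptron: as long as some coordinate `⟪w_j - v_j, y_p⟫` is
too large, a multiple of `± y_p` is added to `v_j`. Each correction decreases `‖w_j - v_j‖²`, so the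
target is reached after boundedly many steps, and the approximants are counted by the words of
labels `(j, p, ±)`. The step length grows with the square root of the number of corrections already
made to `w_j`; this splits the error among the coordinates in proportion to `‖w_j‖`, as a bound on
`∑ j, ‖w_j‖` requires, without a separate cover of the vector of norms. At radius proportional to
`2 ^ (-k)` the logarithm of the number of approximants is `(4 ^ k - 1) log (1 + 4 d N M)` up to a
constant.

*From the cover to the theorem.* With covering numbers of this shape all levels of Dudley's chain
contribute equally, and about `log N` levels suffice (`expect_signSup_le_log`); this gives the factor
`1 + log N`. Symmetrization (`integral_supDev_le`) turns the bound on Rademacher averages into one on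
the mean of the largest gap, and McDiarmid's inequality (`measureReal_ge_le_of_boundedDiff`) adds the
term with `b`. All of this is done for finite families of weights. Since the gap is continuous in the
weights, a countable dense set of weights decides the event for the whole class, and the finite
bounds pass to it along an increasing union (`measure_exists_lt_le_of_finite`). The two-sided
statement is the one-sided one for `ℓ` and for `-ℓ` at level `δ / 2`.
-/

namespace OutEffHop

/-! ### Greedy covers of the (2,1)-ball -/

section GreedyCover

variable {E ι P : Type*} [NormedAddCommGroup E]

/-- The invariant of the greedy approximation of `w`: the `t`-th correction of a member decreases
the squared distance to the target by at least `θ² t`, and a member that was never corrected is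
still zero. -/
def GreedyInv (w : ι → E) (θ : ℝ) (s : (ι → ℕ) × (ι → E)) : Prop :=
  ∀ j, ‖w j - s.2 j‖ ^ 2 + θ ^ 2 * (s.1 j * (s.1 j + 1)) / 2 ≤ ‖w j‖ ^ 2 ∧
    (s.1 j = 0 → s.2 j = 0)

/-- The number of corrections to a member is controlled by its norm. -/
lemma GreedyInv.count_le {w : ι → E} {θ : ℝ} {s : (ι → ℕ) × (ι → E)}
    (hs : GreedyInv w θ s) (j : ι) : θ * s.1 j ≤ 3 / 2 * ‖w j‖ := by
  have h := (hs j).1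
  have h1 : 0 ≤ θ ^ 2 * s.1 j := by positivity
  apply le_of_sq_le_sq _ (by positivity)
  nlinarith [sq_nonneg ‖w j - s.2 j‖, sq_nonneg ‖w j‖]

lemma GreedyInv.sum_count_lt [Fintype ι] {w : ι → E} {B : ℝ} (hB : 0 < B)
    (hw : ∑ j, ‖w j‖ ≤ B) {n : ℕ} (hn : 1 ≤ n) {s : (ι → ℕ) × (ι → E)}
    (hs : GreedyInv w (2 * B / n) s) : ∑ j, s.1 j < n := by
  have hn' : (0 : ℝ) < n := by exact_mod_cast hn
  have h : 2 * B / n * ∑ j, (s.1 j : ℝ) ≤ 3 / 2 * B := by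
    rw [Finset.mul_sum]
    calc _ ≤ ∑ j, 3 / 2 * ‖w j‖ := Finset.sum_le_sum fun j _ => hs.count_le j
      _ ≤ _ := by rw [← Finset.mul_sum]; gcongr
  have h2 : (∑ j, (s.1 j : ℝ)) < n := by
    by_contra hc
    push Not at hc
    have : 2 * B / n * n ≤ 2 * B / n * ∑ j, (s.1 j : ℝ) := by gcongr
    rw [div_mul_cancel₀ _ hn'.ne'] at this
    linarith
  exact_mod_cast h2

variable [InnerProductSpace ℝ E]

/-- When no further correction is called for, the approximation is good at every point. -/
lemma GreedyInv.sum_sq_inner_le [Fintype ι] {y : P → E} {R B : ℝ} (hR : ∀ p, ‖y p‖ ≤ R)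
    (hB : 0 ≤ B) {w : ι → E} (hw : ∑ j, ‖w j‖ ≤ B) {n : ℕ} {s : (ι → ℕ) × (ι → E)}
    (hs : GreedyInv w (2 * B / n) s)
    (hd : ∀ j p, |inner ℝ (w j - s.2 j) (y p)| ≤ R * (2 * B / n) * √(s.1 j + 1)) (p : P) :
    ∑ j, inner ℝ (w j - s.2 j) (y p) ^ 2 ≤ 6 * (R * B) ^ 2 / n := by
  set θ := 2 * B / n with hθ
  have hθ0 : 0 ≤ θ := by positivity
  have hR0 : 0 ≤ R := (norm_nonneg _).trans (hR p)
  have key : ∀ j, inner ℝ (w j - s.2 j) (y p) ^ 2 ≤ 3 * R ^ 2 * θ * ‖w j‖ := by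
    intro j
    have h1 := hd j p
    by_cases hc : s.1 j = 0
    -- Without any correction the trivial bound `R ‖w j‖` brings in the factor `‖w j‖`.
    · rw [(hs j).2 hc, hc] at h1
      rw [(hs j).2 hc]
      simp only [sub_zero, CharP.cast_eq_zero, zero_add, Real.sqrt_one, mul_one] at h1 ⊢
      have h2 : |inner ℝ (w j) (y p)| ≤ ‖w j‖ * R :=
        (abs_real_inner_le_norm _ _).trans (by gcongr; exact hR p)
      rw [← sq_abs, sq]
      calc _ ≤ (R * θ) * (‖w j‖ * R) := by gcongr
        _ ≤ 3 * ((R * θ) * (‖w j‖ * R)) := by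
          have : 0 ≤ (R * θ) * (‖w j‖ * R) := by positivity
          linarith
        _ = _ := by ring
    -- Otherwise the squared error is of the order of the number of corrections, hence of `‖w j‖`.
    · have hc1 : (1 : ℝ) ≤ s.1 j := by exact_mod_cast Nat.one_le_iff_ne_zero.2 hc
      have h2 := hs.count_le j
      rw [← sq_abs]
      calc _ ≤ (R * θ * √(s.1 j + 1)) ^ 2 := by gcongr
        _ = R ^ 2 * θ * (θ * (s.1 j + 1)) := by
          rw [mul_pow, Real.sq_sqrt (by positivity)]; ring
        _ ≤ R ^ 2 * θ * (3 * ‖w j‖) := by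
          refine mul_le_mul_of_nonneg_left ?_ (by positivity)
          nlinarith
        _ = _ := by ring
  calc _ ≤ ∑ j, 3 * R ^ 2 * θ * ‖w j‖ := Finset.sum_le_sum fun j _ => key j
    _ ≤ 3 * R ^ 2 * θ * B := by rw [← Finset.mul_sum]; gcongr
    _ = _ := by rw [hθ]; ring

variable [DecidableEq ι]

/-- One correction step of the greedy approximation of a family `w : ι → E`. A state `(c, v)`
consists of the current approximation `v` and the number `c j` of corrections made so far to its
`j`-th member. The label `(j, p, s)` asks for adding to `v j` a multiple of `± y p`, with the sign
coded by `s` and with the coefficient `θ √(c j + 1) / R`, which grows with the number of corrections.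
-/
noncomputable def greedyStep (y : P → E) (R θ : ℝ) (s : (ι → ℕ) × (ι → E)) (l : ι × P × Bool) :
    (ι → ℕ) × (ι → E) :=
  (Function.update s.1 l.1 (s.1 l.1 + 1),
    Function.update s.2 l.1 (s.2 l.1 +
      ((if l.2.2 then 1 else -1) * (θ * √(s.1 l.1 + 1) / R)) • y l.2.1))

open scoped Classical in
/-- The states that can be reached from `(0, 0)` by at most `k` greedy steps. -/
noncomputable def greedyStates [Fintype ι] [Fintype P] (y : P → E) (R θ : ℝ) :
    ℕ → Finset ((ι → ℕ) × (ι → E))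
  | 0 => {0}
  | k + 1 => greedyStates y R θ k ∪
      Finset.image₂ (greedyStep y R θ) (greedyStates y R θ k) Finset.univ

lemma card_greedyStates_le [Fintype ι] [Fintype P] (y : P → E) (R θ : ℝ) (k : ℕ) :
    (greedyStates (ι := ι) y R θ k).card ≤
      (1 + 2 * (Fintype.card ι * Fintype.card P)) ^ k := by
  classical
  induction k with
  | zero => simp [greedyStates]
  | succ k ih =>
    rw [greedyStates]
    refine (Finset.card_union_le _ _).trans ?_
    have h := Finset.card_image₂_le (greedyStep y R θ) (greedyStates (ι := ι) y R θ k)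
      (Finset.univ : Finset (ι × P × Bool))
    have hc : (Finset.univ : Finset (ι × P × Bool)).card
        = 2 * (Fintype.card ι * Fintype.card P) := by
      simp [Finset.card_univ, Fintype.card_prod]; ring
    calc _ ≤ (greedyStates (ι := ι) y R θ k).card + (greedyStates (ι := ι) y R θ k).card *
            (2 * (Fintype.card ι * Fintype.card P)) := by
          rw [hc] at h; exact Nat.add_le_add_left (by convert h) _
      _ = (greedyStates (ι := ι) y R θ k).card * (1 + 2 * (Fintype.card ι * Fintype.card P)) := by
          ring
      _ ≤ _ := by rw [pow_succ]; exact Nat.mul_le_mul_right _ ih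

lemma exists_greedyInv_step [Fintype ι] {y : P → E} {R θ : ℝ} (hR : ∀ p, ‖y p‖ ≤ R) (hθ : 0 ≤ θ)
    {w : ι → E} {s : (ι → ℕ) × (ι → E)} (hs : GreedyInv w θ s) {j : ι} {p : P}
    (h : R * θ * √(s.1 j + 1) < |inner ℝ (w j - s.2 j) (y p)|) :
    ∃ l, GreedyInv w θ (greedyStep y R θ s l) ∧
      ∑ i, (greedyStep y R θ s l).1 i = ∑ i, s.1 i + 1 := by
  have hR0 : 0 ≤ R := (norm_nonneg _).trans (hR p)
  have hRpos : 0 < R := by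
    rcases hR0.eq_or_lt with h0 | h0
    · have : y p = 0 := norm_le_zero_iff.1 ((hR p).trans h0.ge)
      simp [this, ← h0] at h
    · exact h0
  obtain ⟨b, hb⟩ : ∃ b : Bool, R * θ * √(s.1 j + 1) <
      (if b then 1 else -1) * inner ℝ (w j - s.2 j) (y p) := by
    rcases lt_abs.1 h with h | h
    · exact ⟨true, by simpa using h⟩
    · exact ⟨false, by simpa using h⟩
  refine ⟨(j, p, b), fun i => ?_, ?_⟩
  · by_cases hi : i = j
    · subst hi
      refine ⟨?_, by simp [greedyStep]⟩
      simp only [greedyStep, Function.update_self]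
      set e := w i - s.2 i with he
      set η := θ * √(s.1 i + 1) / R with hη
      set σ : ℝ := if b then 1 else -1 with hσ
      have hσ2 : σ ^ 2 = 1 := by rw [hσ]; split_ifs <;> norm_num
      have hη0 : 0 ≤ η := by positivity
      have hηR : η * R = θ * √(s.1 i + 1) := by rw [hη]; field_simp
      have hsq : √((s.1 i : ℝ) + 1) ^ 2 = s.1 i + 1 := Real.sq_sqrt (by positivity)
      have h1 : ‖w i - (s.2 i + (σ * η) • y p)‖ ^ 2
          = ‖e‖ ^ 2 - 2 * (η * (σ * inner ℝ e (y p))) + η ^ 2 * ‖y p‖ ^ 2 := by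
        rw [← sub_sub, ← he, norm_sub_sq_real, inner_smul_right, norm_smul, mul_pow,
          Real.norm_eq_abs, sq_abs, mul_pow, hσ2]
        ring
      have h2 : η ^ 2 * ‖y p‖ ^ 2 ≤ (η * R) ^ 2 := by
        rw [mul_pow]; gcongr; exact hR p
      have h3 : η * (R * θ * √(s.1 i + 1)) ≤ η * (σ * inner ℝ e (y p)) := by gcongr
      have h4 : η * (R * θ * √(s.1 i + 1)) = (η * R) ^ 2 := by
        rw [mul_assoc R, ← hηR]; ring
      have h5 : (η * R) ^ 2 = θ ^ 2 * (s.1 i + 1) := by rw [hηR, mul_pow, hsq]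
      have h6 := (hs i).1
      rw [h1]
      push_cast
      nlinarith
    · simpa [greedyStep, Function.update_of_ne hi] using hs i
  · simp only [greedyStep]
    rw [← Finset.add_sum_erase _ _ (Finset.mem_univ j),
      ← Finset.add_sum_erase _ s.1 (Finset.mem_univ j),
      Function.update_self, Finset.sum_congr rfl fun i hi =>
        Function.update_of_ne (Finset.ne_of_mem_erase hi) _ _]
    ring

/-- **Covering of the `(2,1)`-ball, uniformly on a finite set of points.** The families `w` with
`∑ j, ‖w j‖ ≤ B` are approximated, as maps `x ↦ (⟪w j, x⟫)_j` into Euclidean space, on all points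
`y p` up to squared error `6 (R B)² / n`, by a set whose cardinality depends on `n`, the number of
members and the number of points only; the dimension of `E` does not enter. -/
theorem exists_greedy_cover [Fintype ι] [Fintype P] (y : P → E) {R B : ℝ}
    (hR : ∀ p, ‖y p‖ ≤ R) (hB : 0 ≤ B) {n : ℕ} (hn : 1 ≤ n) :
    ∃ C : Finset (ι → E), C.card ≤ (1 + 2 * (Fintype.card ι * Fintype.card P)) ^ (n - 1) ∧
      ∀ w : ι → E, ∑ j, ‖w j‖ ≤ B →
        ∃ v ∈ C, ∀ p, ∑ j, inner ℝ (w j - v j) (y p) ^ 2 ≤ 6 * (R * B) ^ 2 / n := by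
  classical
  rcases hB.eq_or_lt with rfl | hB
  · refine ⟨{0}, by simpa using Nat.one_le_pow _ _ (by omega),
      fun w hw => ⟨0, by simp, fun p => ?_⟩⟩
    have : ∀ j, w j = 0 := fun j => norm_le_zero_iff.1
      ((Finset.single_le_sum (fun i _ => norm_nonneg (w i)) (Finset.mem_univ j)).trans hw)
    simp [this]
  set θ := 2 * B / n with hθ
  have hθ0 : 0 ≤ θ := by positivity
  refine ⟨(greedyStates y R θ (n - 1)).image Prod.snd,
    Finset.card_image_le.trans (card_greedyStates_le y R θ _), fun w hw => ?_⟩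
  let Done : (ι → ℕ) × (ι → E) → Prop := fun s =>
    ∀ j p, |inner ℝ (w j - s.2 j) (y p)| ≤ R * θ * √(s.1 j + 1)
  have step : ∀ s, GreedyInv w θ s → ¬ Done s → ∃ l, GreedyInv w θ (greedyStep y R θ s l) ∧
      ∑ i, (greedyStep y R θ s l).1 i = ∑ i, s.1 i + 1 := by
    intro s hs hd
    simp only [Done] at hd
    push Not at hd
    obtain ⟨j, p, h⟩ := hd
    exact exists_greedyInv_step hR hθ0 hs h
  have run : ∀ k, ∃ s ∈ greedyStates y R θ k,
      GreedyInv w θ s ∧ (Done s ∨ ∑ i, s.1 i = k) := by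
    intro k
    induction k with
    | zero => exact ⟨0, by simp [greedyStates], fun j => by simp, Or.inr (by simp)⟩
    | succ k ih =>
      obtain ⟨s, hsm, hs, h⟩ := ih
      by_cases hd : Done s
      · exact ⟨s, Finset.mem_union_left _ hsm, hs, Or.inl hd⟩
      · obtain ⟨l, hl, hsum⟩ := step s hs hd
        refine ⟨_, Finset.mem_union_right _ (Finset.mem_image₂_of_mem hsm (Finset.mem_univ l)), hl,
          Or.inr ?_⟩
        rw [hsum, h.resolve_left hd]
  obtain ⟨s, hsm, hs, h⟩ := run (n - 1)
  -- A further correction would make `n` of them, more than the potential allows.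
  have hd : Done s := by
    by_contra hd
    obtain ⟨l, hl, hsum⟩ := step s hs hd
    have := hl.sum_count_lt hB hw hn
    rw [hsum, h.resolve_left hd] at this
    omega
  exact ⟨s.2, Finset.mem_image_of_mem _ hsm, fun p => hs.sum_sq_inner_le hR hB.le hw hd p⟩

end GreedyCover

/-! ### Lipschitz and covering bounds for the layer -/

section Softmax

variable {M : ℕ}

lemma softmax1_nonneg (z : Fin M → ℝ) (μ : Fin M) : 0 ≤ softmax1 z μ := by
  unfold softmax1; positivity

lemma sum_softmax1_le_one (z : Fin M → ℝ) : ∑ μ, softmax1 z μ ≤ 1 := by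
  have h : 0 ≤ ∑ ν, Real.exp (z ν) := by positivity
  simp only [softmax1, ← Finset.sum_div]
  rw [div_le_one (by positivity)]
  linarith

lemma exp_mul_softmax1_le {z z' : Fin M → ℝ} {δ : ℝ} (hδ : 0 ≤ δ) (h : ∀ ν, |z ν - z' ν| ≤ δ)
    (μ : Fin M) : Real.exp (-(2 * δ)) * softmax1 z μ ≤ softmax1 z' μ := by
  unfold softmax1
  have h1 : Real.exp (-δ) * Real.exp (z μ) ≤ Real.exp (z' μ) := by
    rw [← Real.exp_add]
    gcongr
    linarith [(abs_le.1 (h μ)).2]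
  have h2 : ∑ ν, Real.exp (z' ν) + 1 ≤ Real.exp δ * (∑ ν, Real.exp (z ν) + 1) := by
    rw [mul_add, Finset.mul_sum, mul_one]
    gcongr with ν
    · rw [← Real.exp_add]
      gcongr
      linarith [(abs_le.1 (h ν)).1]
    · exact Real.one_le_exp hδ
  have h3 : Real.exp (-δ) * (∑ ν, Real.exp (z' ν) + 1) ≤ ∑ ν, Real.exp (z ν) + 1 := by
    rw [Real.exp_neg, inv_mul_le_iff₀ (Real.exp_pos _)]
    exact h2
  rw [← mul_div_assoc, div_le_div_iff₀ (by positivity) (by positivity)]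
  calc _ = (Real.exp (-δ) * Real.exp (z μ)) *
        (Real.exp (-δ) * (∑ ν, Real.exp (z' ν) + 1)) := by
        rw [show -(2 * δ) = -δ + -δ by ring, Real.exp_add]; ring
    _ ≤ _ := by gcongr

/-- `Softmax₁` is Lipschitz from the supremum norm to the `ℓ₁` norm. -/
lemma sum_abs_softmax1_sub_le {z z' : Fin M → ℝ} {δ : ℝ} (hδ : 0 ≤ δ)
    (h : ∀ ν, |z ν - z' ν| ≤ δ) : ∑ μ, |softmax1 z μ - softmax1 z' μ| ≤ 4 * δ := by
  have key : ∀ μ, |softmax1 z μ - softmax1 z' μ| ≤ 2 * δ * (softmax1 z μ + softmax1 z' μ) := by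
    intro μ
    have h1 := exp_mul_softmax1_le hδ h μ
    have h2 := exp_mul_softmax1_le hδ (z := z') (z' := z)
      (fun ν => by rw [abs_sub_comm]; exact h ν) μ
    have h3 : 1 - 2 * δ ≤ Real.exp (-(2 * δ)) := by
      linarith [Real.add_one_le_exp (-(2 * δ))]
    have s1 := softmax1_nonneg z μ
    have s2 := softmax1_nonneg z' μ
    have h4 := mul_le_mul_of_nonneg_right h3 s1
    have h5 := mul_le_mul_of_nonneg_right h3 s2
    have h6 := mul_nonneg hδ s1
    have h7 := mul_nonneg hδ s2
    rw [abs_le]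
    constructor <;> linarith
  calc _ ≤ ∑ μ, 2 * δ * (softmax1 z μ + softmax1 z' μ) := Finset.sum_le_sum fun μ _ => key μ
    _ = 2 * δ * (∑ μ, softmax1 z μ + ∑ μ, softmax1 z' μ) := by
      rw [← Finset.mul_sum, Finset.sum_add_distrib]
    _ ≤ 2 * δ * (1 + 1) := by gcongr <;> exact sum_softmax1_le_one _
    _ = _ := by ring

end Softmax

section Layer

variable {a d M T : ℕ}

lemma toEuclideanLin_transpose_apply (W : Matrix (Fin a) (Fin d) ℝ)
    (y : EuclideanSpace ℝ (Fin a)) (j : Fin d) :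
    Matrix.toEuclideanLin Wᵀ y j = inner ℝ (WithLp.toLp 2 fun i => W i j) y := by
  simp [Matrix.toLpLin_apply, Matrix.mulVec, dotProduct, PiLp.inner_apply, mul_comm]

/-- The column of the output that belongs to the query `q_τ` is a combination of the projected
memories `W̃_Vᵀ y_t`, with coefficients determined by the products `⟪W_Kᵀ y_t, q_τ⟫`. -/
lemma fHop_col (β : ℝ) (WK WV : Matrix (Fin a) (Fin d) ℝ) (x : Input a d M T) (τ : Fin T) :
    (WithLp.toLp 2 (fun i => fHop β WK WV x i τ) : EuclideanSpace ℝ (Fin d)) =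
      ∑ t, softmax1 (fun ν => β * inner ℝ (Matrix.toEuclideanLin WKᵀ (WithLp.toLp 2 (x.1 ν)))
        (WithLp.toLp 2 (x.2 τ) : EuclideanSpace ℝ (Fin d))) t •
          Matrix.toEuclideanLin WVᵀ (WithLp.toLp 2 (x.1 t)) := by
  have hz : ∀ ν, (β • (x.1 * WK * x.2ᵀ)) ν τ =
      β * inner ℝ (Matrix.toEuclideanLin WKᵀ (WithLp.toLp 2 (x.1 ν)))
        (WithLp.toLp 2 (x.2 τ) : EuclideanSpace ℝ (Fin d)) := by
    intro ν
    simp [Matrix.toLpLin_apply, Matrix.mulVec, dotProduct, PiLp.inner_apply, Matrix.mul_apply,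
      mul_comm]
  ext i
  simp only [fHop, softmax1Cols, Matrix.mul_apply, Matrix.of_apply, hz]
  simp [Matrix.toLpLin_apply, Matrix.mulVec, dotProduct, mul_comm]

lemma norm_toEuclideanLin_le (A : Matrix (Fin a) (Fin d) ℝ) (v : EuclideanSpace ℝ (Fin d)) :
    ‖Matrix.toEuclideanLin A v‖ ≤ specNorm A * ‖v‖ :=
  (LinearMap.toContinuousLinearMap (Matrix.toEuclideanLin A)).le_opNorm v

/-- The output of the layer, as a function of the weights, is Lipschitz in the values
`W_Kᵀ y_t` and `W̃_Vᵀ y_t`, uniformly over the query vectors. -/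
lemma norm2inf_fHop_sub_le {β BY BV ρK ρV : ℝ} {WK WK' WV WV' : Matrix (Fin a) (Fin d) ℝ}
    {x : Input a d M T} (hx : InputBounds BY x) (hBY : 0 ≤ BY) (hV : specNorm WVᵀ ≤ BV)
    (hρK : 0 ≤ ρK) (hρV : 0 ≤ ρV)
    (hdK : ∀ t, ‖Matrix.toEuclideanLin (WK - WK')ᵀ (WithLp.toLp 2 (x.1 t))‖ ≤ ρK)
    (hdV : ∀ t, ‖Matrix.toEuclideanLin (WV - WV')ᵀ (WithLp.toLp 2 (x.1 t))‖ ≤ ρV) :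
    norm2inf (fHop β WK WV x - fHop β WK' WV' x) ≤ ρV + 4 * |β| * BV * BY * ρK := by
  have hBV : 0 ≤ BV := (norm_nonneg _).trans hV
  refine Real.iSup_le (fun τ => ?_) (by positivity)
  set q : EuclideanSpace ℝ (Fin d) := WithLp.toLp 2 (x.2 τ) with hq
  have hq1 : ‖q‖ ≤ 1 := hx.1 τ
  set y : Fin M → EuclideanSpace ℝ (Fin a) := fun t => WithLp.toLp 2 (x.1 t) with hy
  have hy1 : ∀ t, ‖y t‖ ≤ BY := hx.2
  set z : Fin M → ℝ := fun ν => β * inner ℝ (Matrix.toEuclideanLin WKᵀ (y ν)) q with hz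
  set z' : Fin M → ℝ := fun ν => β * inner ℝ (Matrix.toEuclideanLin WK'ᵀ (y ν)) q with hz'
  have hzz : ∀ ν, |z ν - z' ν| ≤ |β| * ρK := by
    intro ν
    have : z ν - z' ν = β * inner ℝ (Matrix.toEuclideanLin (WK - WK')ᵀ (y ν)) q := by
      simp only [hz, hz', Matrix.transpose_sub, map_sub, LinearMap.sub_apply, inner_sub_left]
      ring
    rw [this, abs_mul]
    gcongr
    calc _ ≤ _ := abs_real_inner_le_norm _ _
      _ ≤ ρK * 1 := by gcongr; exact hdK ν
      _ = ρK := mul_one _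
  have hs := sum_abs_softmax1_sub_le (by positivity) hzz
  have hcol : (WithLp.toLp 2 (fun i => (fHop β WK WV x - fHop β WK' WV' x) i τ) :
      EuclideanSpace ℝ (Fin d)) =
      ∑ t, (softmax1 z t - softmax1 z' t) • Matrix.toEuclideanLin WVᵀ (y t) +
        ∑ t, softmax1 z' t • Matrix.toEuclideanLin (WV - WV')ᵀ (y t) := by
    have h1 := fHop_col β WK WV x τ
    have h2 := fHop_col β WK' WV' x τ
    have h3 : (WithLp.toLp 2 (fun i => (fHop β WK WV x - fHop β WK' WV' x) i τ) :
        EuclideanSpace ℝ (Fin d)) = WithLp.toLp 2 (fun i => fHop β WK WV x i τ) -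
          WithLp.toLp 2 (fun i => fHop β WK' WV' x i τ) := rfl
    rw [h3, h1, h2, ← Finset.sum_add_distrib, ← Finset.sum_sub_distrib]
    refine Finset.sum_congr rfl fun t _ => ?_
    simp only [Matrix.transpose_sub, map_sub, LinearMap.sub_apply, sub_smul, smul_sub]
    abel
  unfold l2Norm
  rw [hcol]
  refine (norm_add_le _ _).trans ?_
  rw [add_comm]
  refine add_le_add ?_ ?_
  · refine (norm_sum_le _ _).trans ?_
    calc _ ≤ ∑ t, softmax1 z' t * ρV := by
          refine Finset.sum_le_sum fun t _ => ?_
          rw [norm_smul, Real.norm_of_nonneg (softmax1_nonneg _ _)]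
          exact mul_le_mul_of_nonneg_left (hdV t) (softmax1_nonneg _ _)
      _ ≤ 1 * ρV := by
          rw [← Finset.sum_mul]
          exact mul_le_mul_of_nonneg_right (sum_softmax1_le_one _) hρV
      _ = _ := one_mul _
  · refine (norm_sum_le _ _).trans ?_
    calc _ ≤ ∑ t, |softmax1 z t - softmax1 z' t| * (BV * BY) := by
          refine Finset.sum_le_sum fun t _ => ?_
          rw [norm_smul, Real.norm_eq_abs]
          refine mul_le_mul_of_nonneg_left ?_ (abs_nonneg _)
          exact (norm_toEuclideanLin_le _ _).trans
            (mul_le_mul hV (hy1 t) (norm_nonneg _) hBV)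
      _ ≤ 4 * (|β| * ρK) * (BV * BY) := by
          rw [← Finset.sum_mul]
          exact mul_le_mul_of_nonneg_right hs (by positivity)
      _ = _ := by ring

/-- The matrix form of the greedy cover, at the radius `3 R B / 2 ^ k`. -/
lemma exists_matrix_cover {P : Type*} [Fintype P] (y : P → EuclideanSpace ℝ (Fin a)) {R B : ℝ}
    (hy : ∀ p, ‖y p‖ ≤ R) (hR : 0 ≤ R) (hB : 0 ≤ B) (k : ℕ) :
    ∃ C : Finset (Matrix (Fin a) (Fin d) ℝ),
      C.card ≤ (1 + 2 * (d * Fintype.card P)) ^ (4 ^ k - 1) ∧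
      ∀ W, norm21 W ≤ B → ∃ W' ∈ C, ∀ p,
        ‖Matrix.toEuclideanLin (W - W')ᵀ (y p)‖ ≤ 3 * (R * B) / 2 ^ k := by
  classical
  obtain ⟨C, hC, h⟩ := exists_greedy_cover (ι := Fin d) y hy hB (n := 4 ^ k)
    (Nat.one_le_pow _ _ (by norm_num))
  refine ⟨C.image fun v => Matrix.of fun i j => v j i, Finset.card_image_le.trans
    (by simpa using hC), fun W hW => ?_⟩
  obtain ⟨v, hv, hvp⟩ := h (fun j => WithLp.toLp 2 fun i => W i j) hW
  refine ⟨_, Finset.mem_image_of_mem _ hv, fun p => ?_⟩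
  refine le_of_sq_le_sq ?_ (by positivity)
  rw [EuclideanSpace.norm_sq_eq]
  have h4 : ((4 ^ k : ℕ) : ℝ) = (2 ^ k) ^ 2 := by
    push_cast; rw [← pow_mul, mul_comm, pow_mul]; norm_num
  calc _ = ∑ j, inner ℝ ((WithLp.toLp 2 fun i => W i j) - v j) (y p) ^ 2 := by
        refine Finset.sum_congr rfl fun j _ => ?_
        rw [Real.norm_eq_abs, sq_abs, toEuclideanLin_transpose_apply]
        rfl
    _ ≤ 6 * (R * B) ^ 2 / (4 ^ k : ℕ) := hvp p
    _ ≤ 9 * (R * B) ^ 2 / (4 ^ k : ℕ) := by gcongr; norm_num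
    _ = _ := by rw [h4]; ring

/-- **Covering of the layer.** On finitely many admissible inputs the class of layers is covered in
the norm `‖·‖_{2,∞}` by the layers of finitely many weight pairs, which need not satisfy the norm
constraints. Neither the dimension `a` nor the number of queries enters the count. -/
lemma exists_fHop_cover {κ : Type*} [Fintype κ] {β BY BK BK21 BV BV21 : ℝ} (hBY : 0 ≤ BY)
    (hBK21 : 0 ≤ BK21) (hBV21 : 0 ≤ BV21) (x : κ → Input a d M T)
    (hx : ∀ i, InputBounds BY (x i)) (k : ℕ) :
    ∃ C : Finset (Matrix (Fin a) (Fin d) ℝ × Matrix (Fin a) (Fin d) ℝ),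
      C.card ≤ (1 + 2 * (d * (Fintype.card κ * M))) ^ (2 * (4 ^ k - 1)) ∧
      ∀ WK ∈ weightClass a d BK BK21, ∀ WV ∈ weightClass a d BV BV21, ∃ c ∈ C, ∀ i,
        norm2inf (fHop β WK WV (x i) - fHop β c.1 c.2 (x i)) ≤
          3 * (BY * (BV21 + 4 * |β| * BV * BY * BK21)) / 2 ^ k := by
  classical
  let y : κ × Fin M → EuclideanSpace ℝ (Fin a) := fun p => WithLp.toLp 2 ((x p.1).1 p.2)
  have hy : ∀ p, ‖y p‖ ≤ BY := fun p => (hx p.1).2 p.2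
  obtain ⟨CK, hCK, hK⟩ := exists_matrix_cover (d := d) y hy hBY hBK21 k
  obtain ⟨CV, hCV, hV⟩ := exists_matrix_cover (d := d) y hy hBY hBV21 k
  refine ⟨CK ×ˢ CV, ?_, fun WK hWK WV hWV => ?_⟩
  · rw [Finset.card_product, two_mul (4 ^ k - 1), pow_add]
    rw [Fintype.card_prod, Fintype.card_fin] at hCK hCV
    exact Nat.mul_le_mul hCK hCV
  · obtain ⟨WK', hWK', h1⟩ := hK WK hWK.2
    obtain ⟨WV', hWV', h2⟩ := hV WV hWV.2
    refine ⟨(WK', WV'), Finset.mk_mem_product hWK' hWV', fun i => ?_⟩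
    refine (norm2inf_fHop_sub_le (hx i) hBY hWV.1 (by positivity) (by positivity)
      (fun t => h1 (i, t)) (fun t => h2 (i, t))).trans (le_of_eq ?_)
    ring

end Layer

/-! ### Rademacher averages and chaining -/

section Rademacher

open scoped BigOperators

/-- The real sign `± 1` coded by a Boolean. -/
def boolSign (b : Bool) : ℝ := if b then 1 else -1

variable {ι F : Type*} [Fintype ι]

variable [Fintype F] [Nonempty F]

/-- The largest value over a finite family of vectors of the sum with signs `σ`. -/
noncomputable def signSup (v : F → ι → ℝ) (σ : ι → Bool) : ℝ :=
  Finset.univ.sup' Finset.univ_nonempty fun f => ∑ i, boolSign (σ i) * v f i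

lemma signSup_add_le (v w : F → ι → ℝ) (σ : ι → Bool) :
    signSup (v + w) σ ≤ signSup v σ + signSup w σ := by
  refine Finset.sup'_le _ _ fun f hf => ?_
  have h1 := Finset.le_sup' (fun f => ∑ i, boolSign (σ i) * v f i) hf
  have h2 := Finset.le_sup' (fun f => ∑ i, boolSign (σ i) * w f i) hf
  calc _ = ∑ i, boolSign (σ i) * v f i + ∑ i, boolSign (σ i) * w f i := by
        rw [← Finset.sum_add_distrib]
        exact Finset.sum_congr rfl fun i _ => mul_add _ _ _
    _ ≤ _ := add_le_add h1 h2

lemma signSup_le_of_abs_le {v : F → ι → ℝ} {ε : ℝ} (h : ∀ f i, |v f i| ≤ ε) (σ : ι → Bool) :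
    signSup v σ ≤ Fintype.card ι * ε := by
  refine Finset.sup'_le _ _ fun f _ => ?_
  calc _ ≤ ∑ _i : ι, ε := Finset.sum_le_sum fun i _ => by
        have := abs_le.1 (h f i)
        unfold boolSign
        split_ifs <;> linarith
    _ = _ := by simp

variable [DecidableEq ι]

/-- The moment generating function of a Rademacher sum. -/
lemma expect_exp_signSum_le (v : ι → ℝ) :
    𝔼 σ : ι → Bool, Real.exp (∑ i, boolSign (σ i) * v i) ≤ Real.exp ((∑ i, v i ^ 2) / 2) := by
  have h1 : ∑ σ : ι → Bool, Real.exp (∑ i, boolSign (σ i) * v i) =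
      ∏ i, (Real.exp (v i) + Real.exp (-v i)) := by
    simp_rw [Real.exp_sum]
    have := Finset.prod_univ_sum (fun _ : ι => (Finset.univ : Finset Bool))
      (fun i b => Real.exp (boolSign b * v i))
    rw [Fintype.piFinset_univ] at this
    rw [← this]
    simp [boolSign]
  rw [Fintype.expect_eq_sum_div_card, h1, Fintype.card_pi, Nat.cast_prod, ← Finset.prod_div_distrib,
    Finset.sum_div, Real.exp_sum]
  refine Finset.prod_le_prod (fun i _ => by positivity) fun i _ => ?_
  have := Real.cosh_le_exp_half_sq (v i)
  rw [Real.cosh_eq] at this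
  simpa using this

/-- **Massart's finite class lemma.** The bound depends on the number of distinct vectors only. -/
theorem expect_signSup_le {v : F → ι → ℝ} {V Λ : ℝ} (hV : ∀ f, ∑ i, v f i ^ 2 ≤ V)
    (hΛ : ((Set.range v).ncard : ℝ) ≤ Real.exp Λ) :
    𝔼 σ, signSup v σ ≤ √(2 * V * Λ) := by
  classical
  set e := 𝔼 σ, signSup v σ with he
  have hV0 : 0 ≤ V := (Finset.sum_nonneg fun i _ => sq_nonneg _).trans (hV (Classical.arbitrary F))
  have hcard : ((Finset.univ.image v).card : ℝ) ≤ Real.exp Λ := by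
    rwa [← Set.ncard_coe_finset, Finset.coe_image, Finset.coe_univ, Set.image_univ]
  have key : ∀ l : ℝ, 0 < l → l * e ≤ Λ + l ^ 2 * V / 2 := by
    intro l hl
    set c := Λ + l ^ 2 * V / 2 with hc
    have hmgf : 𝔼 σ, Real.exp (l * signSup v σ) ≤ Real.exp c := by
      calc _ ≤ 𝔼 σ : ι → Bool, ∑ u ∈ Finset.univ.image v,
            Real.exp (∑ i, boolSign (σ i) * (l * u i)) := by
            refine Finset.expect_le_expect fun σ _ => ?_
            obtain ⟨f, -, hf⟩ := Finset.exists_mem_eq_sup' Finset.univ_nonempty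
              fun f => ∑ i, boolSign (σ i) * v f i
            have : Real.exp (l * signSup v σ) = Real.exp (∑ i, boolSign (σ i) * (l * v f i)) := by
              rw [signSup, hf, Finset.mul_sum]
              congr 1
              exact Finset.sum_congr rfl fun i _ => by ring
            rw [this]
            exact Finset.single_le_sum
              (f := fun u : ι → ℝ => Real.exp (∑ i, boolSign (σ i) * (l * u i)))
              (fun u _ => (Real.exp_pos _).le) (Finset.mem_image_of_mem v (Finset.mem_univ f))
        _ = ∑ u ∈ Finset.univ.image v,
            𝔼 σ : ι → Bool, Real.exp (∑ i, boolSign (σ i) * (l * u i)) :=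
            Finset.expect_sum_comm _ _ _
        _ ≤ ∑ u ∈ Finset.univ.image v, Real.exp (l ^ 2 * V / 2) := by
            refine Finset.sum_le_sum fun u hu => ?_
            obtain ⟨f, -, rfl⟩ := Finset.mem_image.1 hu
            refine (expect_exp_signSum_le _).trans ?_
            simp_rw [mul_pow]
            rw [← Finset.mul_sum]
            gcongr
            exact hV f
        _ = (Finset.univ.image v).card * Real.exp (l ^ 2 * V / 2) := by simp
        _ ≤ Real.exp Λ * Real.exp (l ^ 2 * V / 2) := by gcongr
        _ = _ := by rw [← Real.exp_add]
    -- The tangent of `exp` at `c` replaces Jensen's inequality.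
    have htan : ∀ σ, l * signSup v σ ≤ (c - 1) + Real.exp (-c) * Real.exp (l * signSup v σ) := by
      intro σ
      have := Real.add_one_le_exp (-c + l * signSup v σ)
      rw [Real.exp_add] at this
      linarith
    calc l * e = 𝔼 σ, l * signSup v σ := by rw [he, Finset.mul_expect]
      _ ≤ 𝔼 σ, ((c - 1) + Real.exp (-c) * Real.exp (l * signSup v σ)) :=
          Finset.expect_le_expect fun σ _ => htan σ
      _ = (c - 1) + Real.exp (-c) * 𝔼 σ, Real.exp (l * signSup v σ) := by
          rw [Finset.expect_add_distrib, ← Finset.mul_expect, Fintype.expect_const]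
      _ ≤ (c - 1) + Real.exp (-c) * Real.exp c := by gcongr
      _ = c := by rw [← Real.exp_add]; simp
  rcases le_or_gt e 0 with h0 | h0
  · exact h0.trans (Real.sqrt_nonneg _)
  refine Real.le_sqrt_of_sq_le ?_
  rcases hV0.eq_or_lt with hv | hv
  · exfalso
    have := key ((|Λ| + 1) / e) (by positivity)
    rw [div_mul_cancel₀ _ h0.ne', ← hv] at this
    linarith [le_abs_self Λ]
  · have := key (e / V) (by positivity)
    have h2 : e / V * e = e ^ 2 / V := by ring
    have h3 : (e / V) ^ 2 * V / 2 = e ^ 2 / V / 2 := by field_simp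
    rw [h2, h3] at this
    have h4 : e ^ 2 / V ≤ 2 * Λ := by linarith
    rw [div_le_iff₀ hv] at h4
    linarith

/-- **Dudley's chaining bound** in discrete form: `a k` approximates `h` up to `ε / 2 ^ k` and takes
at most `exp (Δ (4 ^ k - 1))` values, so that every step of the chain contributes equally. -/
theorem expect_signSup_le_of_chain {h : F → ι → ℝ} {a : ℕ → F → ι → ℝ} {ε Δ : ℝ} (hε : 0 ≤ ε)
    (hΔ : 0 ≤ Δ) (ha : ∀ k f i, |h f i - a k f i| ≤ ε / 2 ^ k)
    (hc : ∀ k, ((Set.range (a k)).ncard : ℝ) ≤ Real.exp (Δ * (4 ^ k - 1))) (K : ℕ) :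
    𝔼 σ, signSup h σ ≤ K * (6 * ε * √(Fintype.card ι * Δ)) + Fintype.card ι * (ε / 2 ^ K) := by
  -- `a 0` takes a single value, so the start of the chain contributes nothing, whatever its size.
  have hzero : 𝔼 σ, signSup (a 0) σ ≤ 0 := by
    have := expect_signSup_le (v := a 0) (V := ∑ f, ∑ i, a 0 f i ^ 2) (Λ := 0)
      (fun f => Finset.single_le_sum (f := fun f => ∑ i, a 0 f i ^ 2)
        (fun f _ => Finset.sum_nonneg fun i _ => sq_nonneg _) (Finset.mem_univ f))
      (by simpa using hc 0)
    simpa using this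
  have hstep : ∀ k, 𝔼 σ, signSup (a (k + 1) - a k) σ ≤ 6 * ε * √(Fintype.card ι * Δ) := by
    intro k
    have hd : ∀ f i, |a (k + 1) f i - a k f i| ≤ 3 * ε / 2 ^ (k + 1) := by
      intro f i
      have h1 := abs_le.1 (ha k f i)
      have h2 := abs_le.1 (ha (k + 1) f i)
      have h3 : ε / 2 ^ k = 2 * (ε / 2 ^ (k + 1)) := by rw [pow_succ]; field_simp
      have h4 : 3 * ε / 2 ^ (k + 1) = 3 * (ε / 2 ^ (k + 1)) := by ring
      rw [h3] at h1
      rw [h4, abs_le]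
      constructor <;> linarith
    have hV : ∀ f, ∑ i, (a (k + 1) - a k) f i ^ 2 ≤
        Fintype.card ι * (3 * ε / 2 ^ (k + 1)) ^ 2 := by
      intro f
      calc _ ≤ ∑ _i : ι, (3 * ε / 2 ^ (k + 1)) ^ 2 := Finset.sum_le_sum fun i _ => by
            rw [← sq_abs]
            exact pow_le_pow_left₀ (abs_nonneg _) (hd f i) 2
        _ = _ := by simp
    have hcard : ((Set.range (a (k + 1) - a k)).ncard : ℝ) ≤
        Real.exp (Δ * (2 * 4 ^ (k + 1))) := by
      have hfin : ∀ k, (Set.range (a k)).Finite := fun k => Set.finite_range _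
      have hsub : Set.range (a (k + 1) - a k) ⊆
          (fun p : (ι → ℝ) × (ι → ℝ) => p.1 - p.2) ''
            (Set.range (a (k + 1)) ×ˢ Set.range (a k)) := by
        rintro _ ⟨f, rfl⟩
        exact ⟨(a (k + 1) f, a k f), ⟨⟨f, rfl⟩, ⟨f, rfl⟩⟩, rfl⟩
      have h1 := (Set.ncard_le_ncard hsub (((hfin _).prod (hfin _)).image _)).trans
        (Set.ncard_image_le ((hfin _).prod (hfin _)))
      rw [Set.ncard_prod] at h1
      calc _ ≤ ((Set.range (a (k + 1))).ncard : ℝ) * (Set.range (a k)).ncard := by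
            exact_mod_cast h1
        _ ≤ Real.exp (Δ * (4 ^ (k + 1) - 1)) * Real.exp (Δ * (4 ^ k - 1)) := by
            gcongr
            · exact hc _
            · exact hc _
        _ ≤ _ := by
            rw [← Real.exp_add, ← mul_add]
            gcongr
            have : (4 : ℝ) ^ k ≤ 4 ^ (k + 1) := pow_le_pow_right₀ (by norm_num) (by omega)
            linarith
    refine (expect_signSup_le hV hcard).trans (le_of_eq ?_)
    have h4 : (4 : ℝ) ^ (k + 1) = (2 ^ (k + 1)) ^ 2 := by
      rw [← pow_mul, mul_comm, pow_mul]; norm_num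
    have h5 : 2 * (Fintype.card ι * (3 * ε / 2 ^ (k + 1)) ^ 2) * (Δ * (2 * 4 ^ (k + 1))) =
        (6 * ε) ^ 2 * (Fintype.card ι * Δ) := by
      rw [h4]; field_simp; ring
    rw [h5, Real.sqrt_mul (sq_nonneg _), Real.sqrt_sq (by positivity)]
  have hlev : ∀ K : ℕ, 𝔼 σ, signSup (a K) σ ≤ K * (6 * ε * √(Fintype.card ι * Δ)) := by
    intro K
    induction K with
    | zero => simpa using hzero
    | succ k ih =>
      calc _ ≤ 𝔼 σ, (signSup (a k) σ + signSup (a (k + 1) - a k) σ) :=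
            Finset.expect_le_expect fun σ _ => by
              have := signSup_add_le (a k) (a (k + 1) - a k) σ
              rwa [add_sub_cancel] at this
        _ ≤ _ := by
            rw [Finset.expect_add_distrib]
            push_cast
            linarith [hstep k]
  calc _ ≤ 𝔼 σ, (signSup (a K) σ + Fintype.card ι * (ε / 2 ^ K)) :=
        Finset.expect_le_expect fun σ _ => by
          have h1 := signSup_add_le (a K) (h - a K) σ
          rw [add_sub_cancel] at h1
          have h2 := signSup_le_of_abs_le (v := h - a K) (fun f i => ha K f i) σ
          linarith
    _ ≤ _ := by
        rw [Finset.expect_add_distrib, Fintype.expect_const]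
        gcongr
        exact hlev K

/-- The chaining bound with `⌊log₂ N⌋ + 1` levels, after which the remaining error `N ε / 2 ^ K` is at
most `ε`. -/
theorem expect_signSup_le_log {h : F → ι → ℝ} {a : ℕ → F → ι → ℝ} {ε Δ : ℝ} (hε : 0 ≤ ε)
    (hΔ : 1 ≤ Δ) (hι : 1 ≤ Fintype.card ι) (ha : ∀ k f i, |h f i - a k f i| ≤ ε / 2 ^ k)
    (hc : ∀ k, ((Set.range (a k)).ncard : ℝ) ≤ Real.exp (Δ * (4 ^ k - 1))) :
    𝔼 σ, signSup h σ ≤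
      13 * (1 + Real.log (Fintype.card ι)) * (ε * √(Fintype.card ι * Δ)) := by
  set N := Fintype.card ι with hN
  have hN1 : (1 : ℝ) ≤ N := by exact_mod_cast hι
  refine (expect_signSup_le_of_chain hε (by linarith) ha hc (Nat.log 2 N + 1)).trans ?_
  have hlogN : 0 ≤ Real.log N := Real.log_nonneg hN1
  have hK : ((Nat.log 2 N + 1 : ℕ) : ℝ) ≤ 2 * (1 + Real.log N) := by
    have h1 : ((2 ^ Nat.log 2 N : ℕ) : ℝ) ≤ N := by
      exact_mod_cast Nat.pow_log_le_self 2 (by omega)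
    have h2 := Real.log_le_log (by positivity) h1
    push_cast at h2 ⊢
    rw [Real.log_pow] at h2
    have h3 := Real.log_two_gt_d9
    have h4 : (0 : ℝ) ≤ (Nat.log 2 N : ℝ) := by positivity
    nlinarith
  have hpow : (N : ℝ) ≤ 2 ^ (Nat.log 2 N + 1) := by
    exact_mod_cast (Nat.lt_pow_succ_log_self (by norm_num) N).le
  have hlast : N * (ε / 2 ^ (Nat.log 2 N + 1)) ≤ ε := by
    rw [← mul_div_assoc, div_le_iff₀ (by positivity), mul_comm]
    gcongr
  have hs : 1 ≤ √(N * Δ) := Real.one_le_sqrt.2 (by nlinarith)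
  have h6 : ε ≤ (1 + Real.log N) * (ε * √(N * Δ)) := by
    calc ε = 1 * (ε * 1) := by ring
      _ ≤ _ := by gcongr; linarith
  calc _ ≤ 2 * (1 + Real.log N) * (6 * ε * √(N * Δ)) + (1 + Real.log N) * (ε * √(N * Δ)) := by
        refine add_le_add ?_ (hlast.trans h6)
        gcongr
    _ = _ := by ring

end Rademacher

/-! ### McDiarmid's inequality -/

section BoundedDifferences

open ProbabilityTheory

variable {Z : Type*} [MeasurableSpace Z]

lemma integrable_of_measurable_of_abs_le {μ : Measure Z} [IsFiniteMeasure μ] {f : Z → ℝ} {C : ℝ}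
    (hf : Measurable f) (hC : ∀ z, |f z| ≤ C) : Integrable f μ :=
  Integrable.of_bound hf.aestronglyMeasurable C (Filter.Eventually.of_forall hC)

lemma abs_exp_mul_sub_le (l m : ℝ) {x C : ℝ} (hx : |x| ≤ C) :
    |Real.exp (l * (x - m))| ≤ Real.exp (|l| * (C + |m|)) := by
  rw [abs_of_pos (Real.exp_pos _), Real.exp_le_exp]
  calc _ ≤ |l * (x - m)| := le_abs_self _
    _ = |l| * |x - m| := abs_mul _ _
    _ ≤ _ := by
      gcongr
      exact (abs_sub _ _).trans (by gcongr)

/-- A function of independent variables that changes by at most `c` when a single variable changes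
has a sub-Gaussian moment generating function. The proof integrates out one variable at a time. -/
lemma integral_exp_le_of_boundedDiff (D : Measure Z) [IsProbabilityMeasure D] {c C : ℝ} :
    ∀ {N : ℕ} {Φ : (Fin N → Z) → ℝ}, Measurable Φ → (∀ S, |Φ S| ≤ C) →
      (∀ S i z, |Φ (Function.update S i z) - Φ S| ≤ c) → ∀ l : ℝ,
      ∫ S, Real.exp (l * (Φ S - ∫ S', Φ S' ∂Measure.pi fun _ => D)) ∂(Measure.pi fun _ => D) ≤
        Real.exp (N * c ^ 2 * l ^ 2 / 2) := by
  intro N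
  induction N with
  | zero =>
    intro Φ _ _ _ l
    have h : ∀ S : Fin 0 → Z, Φ S = Φ Fin.elim0 := fun S => congrArg Φ (Subsingleton.elim _ _)
    simp [h]
  | succ N ih =>
    intro Φ hm hC hc l
    have hZ : Nonempty Z := nonempty_of_isProbabilityMeasure D
    set ν : Measure (Fin N → Z) := Measure.pi fun _ => D with hν
    have hmp := measurePreserving_piFinSuccAbove (fun _ : Fin (N + 1) => D) 0
    have hcons : Measurable fun p : Z × (Fin N → Z) => (Fin.cons p.1 p.2 : Fin (N + 1) → Z) := by
      refine measurable_pi_iff.2 fun i => ?_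
      refine Fin.cases ?_ (fun j => ?_) i
      · simpa using measurable_fst
      · simp only [Fin.cons_succ]; fun_prop
    have hint : ∀ G : (Fin (N + 1) → Z) → ℝ, ∫ S, G S ∂(Measure.pi fun _ => D) =
        ∫ p : Z × (Fin N → Z), G (Fin.cons p.1 p.2) ∂(D.prod ν) := by
      intro G
      have := hmp.symm.integral_comp' (g := G)
      rw [← this]
      refine integral_congr_ae (Filter.Eventually.of_forall fun p => ?_)
      simp [MeasurableEquiv.piFinSuccAbove, Fin.insertNthEquiv]
    set Ψ : (Fin N → Z) → ℝ := fun S => ∫ z, Φ (Fin.cons z S) ∂D with hΨ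
    have hΦm : Measurable fun p : Z × (Fin N → Z) => Φ (Fin.cons p.1 p.2) := hm.comp hcons
    have hsec : ∀ S : Fin N → Z, Measurable fun z => Φ (Fin.cons z S) := fun S =>
      hΦm.comp (measurable_id.prodMk measurable_const)
    have hsint : ∀ S : Fin N → Z, Integrable (fun z => Φ (Fin.cons z S)) D := fun S =>
      integrable_of_measurable_of_abs_le (hsec S) fun z => hC _
    have hΨm : Measurable Ψ :=
      (hΦm.stronglyMeasurable.integral_prod_left' (μ := D)).measurable
    have hΨC : ∀ S, |Ψ S| ≤ C := by
      intro S
      have := norm_integral_le_of_norm_le_const (μ := D) (f := fun z => Φ (Fin.cons z S))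
        (Filter.Eventually.of_forall fun z => hC _)
      simpa using this
    have hΨc : ∀ S i z, |Ψ (Function.update S i z) - Ψ S| ≤ c := by
      intro S i z
      rw [hΨ]
      simp only
      rw [← integral_sub (hsint _) (hsint _)]
      have := norm_integral_le_of_norm_le_const (μ := D) (C := c)
        (f := fun z' => Φ (Fin.cons z' (Function.update S i z)) - Φ (Fin.cons z' S))
        (Filter.Eventually.of_forall fun z' => by
          rw [Fin.cons_update]
          exact hc _ _ _)
      simpa using this
    have hmean : ∫ S, Φ S ∂(Measure.pi fun _ => D) = ∫ S, Ψ S ∂ν := by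
      rw [hint, integral_prod_symm]
      exact integrable_of_measurable_of_abs_le hΦm fun p => hC _
    set m := ∫ S, Ψ S ∂ν with hmdef
    have hinner : ∀ S, ∫ z, Real.exp (l * (Φ (Fin.cons z S) - m)) ∂D ≤
        Real.exp (c ^ 2 * l ^ 2 / 2) * Real.exp (l * (Ψ S - m)) := by
      intro S
      obtain ⟨z₀⟩ := hZ
      -- Hoeffding's lemma on an interval of length `2 c` around the value at a reference point.
      have hsg := hasSubgaussianMGF_of_mem_Icc (μ := D) (X := fun z => Φ (Fin.cons z S))
        (a := Φ (Fin.cons z₀ S) - c) (b := Φ (Fin.cons z₀ S) + c) (hsec S).aemeasurable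
        (Filter.Eventually.of_forall fun z => by
          have := abs_le.1 (hc (Fin.cons z₀ S) 0 z)
          rw [Fin.update_cons_zero] at this
          constructor <;> linarith)
      have h1 := hsg.mgf_le l
      have h2 : ∀ z, Real.exp (l * (Φ (Fin.cons z S) - m)) =
          Real.exp (l * (Φ (Fin.cons z S) - Ψ S)) * Real.exp (l * (Ψ S - m)) := by
        intro z; rw [← Real.exp_add]; congr 1; ring
      simp_rw [h2]
      rw [integral_mul_const]
      gcongr
      refine h1.trans (le_of_eq ?_)
      congr 2
      push_cast
      rw [Real.norm_eq_abs, div_pow, sq_abs]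
      ring
    rw [hmean, hint, integral_prod_symm _ (integrable_of_measurable_of_abs_le
      (by fun_prop) fun p => abs_exp_mul_sub_le l m (hC _))]
    calc _ ≤ ∫ S, Real.exp (c ^ 2 * l ^ 2 / 2) * Real.exp (l * (Ψ S - m)) ∂ν := by
          refine integral_mono ?_ ?_ hinner
          · refine Integrable.integral_prod_right (f := fun p : Z × (Fin N → Z) =>
              Real.exp (l * (Φ (Fin.cons p.1 p.2) - m))) (integrable_of_measurable_of_abs_le
              (by fun_prop) fun p => abs_exp_mul_sub_le l m (hC _))
          · exact (integrable_of_measurable_of_abs_le (by fun_prop)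
              fun S => abs_exp_mul_sub_le l m (hΨC S)).const_mul _
      _ ≤ Real.exp (c ^ 2 * l ^ 2 / 2) * Real.exp (N * c ^ 2 * l ^ 2 / 2) := by
          rw [integral_const_mul]
          gcongr
          exact ih hΨm hΨC hΨc l
      _ = _ := by
          rw [← Real.exp_add]
          congr 1
          push_cast
          ring

/-- **McDiarmid's inequality**, with a non-optimal constant in the exponent. -/
theorem measureReal_ge_le_of_boundedDiff (D : Measure Z) [IsProbabilityMeasure D] {c C : ℝ} {N : ℕ}
    {Φ : (Fin N → Z) → ℝ} (hm : Measurable Φ) (hC : ∀ S, |Φ S| ≤ C)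
    (hc : ∀ S i z, |Φ (Function.update S i z) - Φ S| ≤ c) {t : ℝ} (ht : 0 ≤ t) :
    (Measure.pi fun _ => D).real {S | t ≤ Φ S - ∫ S', Φ S' ∂Measure.pi fun _ => D} ≤
      Real.exp (-t ^ 2 / (2 * (N * c ^ 2))) := by
  set m := ∫ S', Φ S' ∂Measure.pi fun _ : Fin N => D with hmdef
  have hsg : HasSubgaussianMGF (fun S => Φ S - m) ⟨N * c ^ 2, by positivity⟩
      (Measure.pi fun _ : Fin N => D) := by
    refine ⟨fun l => ?_, fun l => integral_exp_le_of_boundedDiff D hm hC hc l⟩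
    refine integrable_of_measurable_of_abs_le (C := Real.exp (|l| * (C + |m|))) (by fun_prop)
      fun S => abs_exp_mul_sub_le l m (hC S)
  exact hsg.measure_ge_le ht

end BoundedDifferences

/-! ### Symmetrization -/

section Symmetrization

open scoped BigOperators

variable {Z F : Type*} [Fintype F] [Nonempty F]

lemma abs_sup'_univ_le {φ : F → ℝ} {C : ℝ} (h : ∀ f, |φ f| ≤ C) :
    |Finset.univ.sup' Finset.univ_nonempty φ| ≤ C := by
  obtain ⟨f, -, hf⟩ := Finset.exists_mem_eq_sup' Finset.univ_nonempty φ
  rw [hf]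
  exact h f

/-- The largest difference, over a finite family, between the sums on the two halves of a double
sample. -/
noncomputable def ghostSup (g : F → Z → ℝ) {N : ℕ} (w : Fin N → Z × Z) : ℝ :=
  Finset.univ.sup' Finset.univ_nonempty fun f => ∑ i, (g f (w i).2 - g f (w i).1)

lemma abs_sum_le_card_mul {N : ℕ} {b : ℝ} {v : Fin N → ℝ} (h : ∀ i, |v i| ≤ b) :
    |∑ i, v i| ≤ N * b :=
  calc _ ≤ ∑ i, |v i| := Finset.abs_sum_le_sum_abs _ _
    _ ≤ ∑ _i : Fin N, b := Finset.sum_le_sum fun i _ => h i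
    _ = _ := by simp

lemma abs_ghostSup_le {g : F → Z → ℝ} {N : ℕ} {b : ℝ} (h : ∀ f z, |g f z| ≤ b)
    (w : Fin N → Z × Z) :
    |ghostSup g w| ≤ N * (2 * b) :=
  abs_sup'_univ_le fun f => abs_sum_le_card_mul fun i => (abs_sub _ _).trans
    (by linarith [h f (w i).1, h f (w i).2])

variable [MeasurableSpace Z]

/-- The largest deviation, over a finite family of functions, between the mean and the average on
the sample `S`. -/
noncomputable def supDev (D : Measure Z) (g : F → Z → ℝ) {N : ℕ} (S : Fin N → Z) : ℝ :=
  Finset.univ.sup' Finset.univ_nonempty fun f => ∫ z, g f z ∂D - (∑ i, g f (S i)) / N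

lemma measurable_sup'_univ {Y : Type*} [MeasurableSpace Y] {φ : F → Y → ℝ}
    (h : ∀ f, Measurable (φ f)) :
    Measurable fun y => Finset.univ.sup' Finset.univ_nonempty fun f => φ f y := by
  have := Finset.measurable_sup' (s := Finset.univ) Finset.univ_nonempty fun f _ => h f
  convert this using 1
  ext y
  simp [Finset.sup'_apply]

lemma measurable_supDev (D : Measure Z) {g : F → Z → ℝ} (hg : ∀ f, Measurable (g f)) {N : ℕ} :
    Measurable (supDev D g (N := N)) :=
  measurable_sup'_univ fun f => by fun_prop

lemma abs_sum_div_le {N : ℕ} {b : ℝ} (hb : 0 ≤ b) {v : Fin N → ℝ} (h : ∀ i, |v i| ≤ b) :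
    |(∑ i, v i) / N| ≤ b := by
  rw [abs_div, Nat.abs_cast]
  refine div_le_of_le_mul₀ (by positivity) hb ?_
  calc _ ≤ ∑ i, |v i| := Finset.abs_sum_le_sum_abs _ _
    _ ≤ ∑ _i : Fin N, b := Finset.sum_le_sum fun i _ => h i
    _ = _ := by simp [mul_comm]

lemma abs_integral_le_of_abs_le {D : Measure Z} [IsProbabilityMeasure D] {g : Z → ℝ} {b : ℝ}
    (h : ∀ z, |g z| ≤ b) : |∫ z, g z ∂D| ≤ b := by
  simpa using norm_integral_le_of_norm_le_const (μ := D) (f := g) (Filter.Eventually.of_forall h)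

lemma abs_supDev_le {D : Measure Z} [IsProbabilityMeasure D] {g : F → Z → ℝ} {b : ℝ} (hb : 0 ≤ b)
    (h : ∀ f z, |g f z| ≤ b) {N : ℕ} (S : Fin N → Z) : |supDev D g S| ≤ 2 * b := by
  refine abs_sup'_univ_le fun f => (abs_sub _ _).trans ?_
  linarith [abs_integral_le_of_abs_le (D := D) (h f),
    abs_sum_div_le hb fun i => h f (S i)]

lemma supDev_update_sub_le {D : Measure Z} {g : F → Z → ℝ} {b : ℝ}
    (h : ∀ f z, |g f z| ≤ b) {N : ℕ} (S : Fin N → Z) (i : Fin N) (z : Z) :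
    supDev D g (Function.update S i z) - supDev D g S ≤ 2 * b / N := by
  rw [sub_le_iff_le_add]
  refine Finset.sup'_le _ _ fun f hf => ?_
  have h1 := Finset.le_sup' (fun f => ∫ z, g f z ∂D - (∑ i, g f (S i)) / N) hf
  have h2 : ∑ j, g f (S j) - ∑ j, g f (Function.update S i z j) = g f (S i) - g f z := by
    rw [← Finset.sum_sub_distrib, Finset.sum_eq_single i]
    · simp
    · intro j _ hj
      simp [Function.update_of_ne hj]
    · simp
  have h3 : g f (S i) - g f z ≤ 2 * b := by
    linarith [(abs_le.1 (h f (S i))).2, (abs_le.1 (h f z)).1]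
  have h4 : (∑ j, g f (S j)) / N - (∑ j, g f (Function.update S i z j)) / N ≤ 2 * b / N := by
    rw [← sub_div, h2]
    gcongr
  unfold supDev
  linarith

lemma abs_supDev_update_sub_le {D : Measure Z} {g : F → Z → ℝ} {b : ℝ}
    (h : ∀ f z, |g f z| ≤ b) {N : ℕ} (S : Fin N → Z) (i : Fin N) (z : Z) :
    |supDev D g (Function.update S i z) - supDev D g S| ≤ 2 * b / N := by
  refine abs_sub_le_iff.2 ⟨supDev_update_sub_le h S i z, ?_⟩
  have := supDev_update_sub_le (D := D) h (Function.update S i z) i (S i)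
  simpa using this

variable {D : Measure Z} [IsProbabilityMeasure D] {g : F → Z → ℝ} {b : ℝ} {N : ℕ}

lemma measurable_ghostSup (hg : ∀ f, Measurable (g f)) : Measurable (ghostSup g (N := N)) :=
  measurable_sup'_univ fun f => by fun_prop

/-- The mean of the largest deviation is controlled with the help of a second, independent sample.
-/
lemma integral_supDev_le_ghostSup (hg : ∀ f, Measurable (g f)) (h : ∀ f z, |g f z| ≤ b)
    (hN : 1 ≤ N) :
    ∫ S, supDev D g S ∂(Measure.pi fun _ : Fin N => D) ≤
      (∫ w, ghostSup g w ∂(Measure.pi fun _ : Fin N => D.prod D)) / N := by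
  set ν : Measure (Fin N → Z) := Measure.pi fun _ => D with hν
  have hN' : (0 : ℝ) < N := by exact_mod_cast hN
  let G : (Fin N → Z) × (Fin N → Z) → ℝ := fun p => ghostSup g fun i => (p.1 i, p.2 i)
  have hGm : Measurable G := (measurable_ghostSup hg).comp (by fun_prop)
  have hGi : Integrable G (ν.prod ν) :=
    integrable_of_measurable_of_abs_le hGm fun p => abs_ghostSup_le h _
  have hb : 0 ≤ b := by
    have : Nonempty Z := nonempty_of_isProbabilityMeasure D
    exact (abs_nonneg _).trans (h (Classical.arbitrary F) (Classical.arbitrary Z))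
  have h1 : ∫ w, ghostSup g w ∂(Measure.pi fun _ : Fin N => D.prod D) = ∫ p, G p ∂(ν.prod ν) := by
    have := (measurePreserving_arrowProdEquivProdArrow Z Z (Fin N) (fun _ => D)
      (fun _ => D)).integral_comp' (g := G)
    rw [← this]
    rfl
  rw [h1, integral_prod _ hGi, ← integral_div]
  refine integral_mono (integrable_of_measurable_of_abs_le (measurable_supDev D hg)
    (abs_supDev_le hb h)) (hGi.integral_prod_left.div_const _) fun S => ?_
  refine Finset.sup'_le _ _ fun f hf => ?_
  have hmean : ∀ i, ∫ S' : Fin N → Z, g f (S' i) ∂ν = ∫ z, g f z ∂D := fun i =>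
    integral_comp_eval (μ := fun _ : Fin N => D) (hg f).aestronglyMeasurable
  have hgi : ∀ i, Integrable (fun S' : Fin N → Z => g f (S' i)) ν := fun i =>
    integrable_of_measurable_of_abs_le (by fun_prop) fun S' => h f (S' i)
  have hgs : ∀ i, Integrable (fun S' : Fin N → Z => g f (S' i) - g f (S i)) ν := fun i =>
    (hgi i).sub (integrable_const _)
  have h2 : ∫ S', ∑ i, (g f (S' i) - g f (S i)) ∂ν = N * ∫ z, g f z ∂D - ∑ i, g f (S i) := by
    rw [integral_finsetSum _ fun i _ => hgs i]
    simp_rw [integral_sub (hgi _) (integrable_const _), hmean]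
    simp
  have h3 : ∫ z, g f z ∂D - (∑ i, g f (S i)) / N = (∫ S', ∑ i, (g f (S' i) - g f (S i)) ∂ν) / N := by
    rw [h2]
    field_simp
  rw [h3]
  gcongr ?_ / _
  refine integral_mono (integrable_finsetSum _ fun i _ => hgs i)
    (integrable_of_measurable_of_abs_le (hGm.comp measurable_prodMk_left)
      fun S' => abs_ghostSup_le h _) fun S' => ?_
  exact Finset.le_sup' (fun f => ∑ i, (g f (S' i) - g f (S i))) hf

/-- **Symmetrization.** Exchanging the two halves of single pairs preserves the law of the double
sample, hence the Rademacher averages of the differences control the mean of the largest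
deviation. -/
theorem integral_supDev_le (hg : ∀ f, Measurable (g f)) (h : ∀ f z, |g f z| ≤ b)
    (hN : 1 ≤ N) {ρ : ℝ}
    (hρ : ∀ᵐ w ∂(Measure.pi fun _ : Fin N => D.prod D),
      𝔼 σ, signSup (fun f i => g f (w i).2 - g f (w i).1) σ ≤ N * ρ) :
    ∫ S, supDev D g S ∂(Measure.pi fun _ : Fin N => D) ≤ ρ := by
  have hN' : (0 : ℝ) < N := by exact_mod_cast hN
  refine (integral_supDev_le_ghostSup hg h hN).trans ?_
  rw [div_le_iff₀ hN', mul_comm]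
  set μ : Measure (Fin N → Z × Z) := Measure.pi fun _ => D.prod D with hμ
  let A : (Fin N → Bool) → (Fin N → Z × Z) → ℝ := fun σ w =>
    signSup (fun f i => g f (w i).2 - g f (w i).1) σ
  have hAm : ∀ σ, Measurable (A σ) := fun σ => measurable_sup'_univ fun f => by fun_prop
  have hAi : ∀ σ, Integrable (A σ) μ := fun σ =>
    integrable_of_measurable_of_abs_le (C := N * (2 * b)) (hAm σ) fun w =>
      abs_sup'_univ_le fun f => abs_sum_le_card_mul fun i => by
        rw [abs_mul, boolSign]
        have h1 := (abs_sub (g f (w i).2) (g f (w i).1)).trans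
          (add_le_add (h f (w i).2) (h f (w i).1))
        split_ifs <;> simp <;> linarith
  have hswap : ∀ σ, ∫ w, A σ w ∂μ = ∫ w, ghostSup g w ∂μ := by
    intro σ
    -- The sign `-1` at `i` exchanges the two halves of the `i`-th pair.
    let τ : Bool → Z × Z → Z × Z := fun s => if s then id else Prod.swap
    have hτ : ∀ s, MeasurePreserving (τ s) (D.prod D) (D.prod D) := by
      intro s
      cases s
      · exact Measure.measurePreserving_swap
      · exact MeasurePreserving.id _
    have hmp : MeasurePreserving (fun (w : Fin N → Z × Z) i => τ (σ i) (w i)) μ μ :=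
      measurePreserving_pi _ _ fun i => hτ (σ i)
    have h1 : ∀ w : Fin N → Z × Z, A σ w = ghostSup g fun i => τ (σ i) (w i) := by
      intro w
      simp only [A, signSup, ghostSup]
      congr 1
      ext f
      refine Finset.sum_congr rfl fun i _ => ?_
      cases hs : σ i <;> simp [τ, boolSign]
    simp_rw [h1]
    rw [← integral_map (φ := fun (w : Fin N → Z × Z) i => τ (σ i) (w i)) (f := ghostSup g)
      hmp.measurable.aemeasurable (measurable_ghostSup hg).aestronglyMeasurable, hmp.map_eq]
  have hmean : ∫ w, ghostSup g w ∂μ = ∫ w, 𝔼 σ, A σ w ∂μ := by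
    simp_rw [Fintype.expect_eq_sum_div_card]
    rw [integral_div, integral_finsetSum _ fun σ _ => hAi σ]
    simp_rw [hswap]
    simp
  rw [hmean]
  calc _ ≤ ∫ _w, (N * ρ) ∂μ := by
        refine integral_mono_ae ?_ (integrable_const _) hρ
        simp_rw [Fintype.expect_eq_sum_div_card]
        exact (integrable_finsetSum _ fun σ _ => hAi σ).div_const _
    _ = _ := by simp

/-- A uniform deviation bound for finite families, from a bound on Rademacher averages. -/
theorem measure_exists_gap_gt_le (hg : ∀ f, Measurable (g f)) (h : ∀ f z, |g f z| ≤ b) (hb : 0 < b)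
    (hN : 1 ≤ N) {ρ : ℝ}
    (hρ : ∀ᵐ w ∂(Measure.pi fun _ : Fin N => D.prod D),
      𝔼 σ, signSup (fun f i => g f (w i).2 - g f (w i).1) σ ≤ N * ρ)
    {δ : ℝ} (hδ : 0 < δ) :
    (Measure.pi fun _ : Fin N => D) {S | ∃ f,
      ρ + 1 / √N * (3 * b * √(Real.log (1 / δ))) < ∫ z, g f z ∂D - (∑ i, g f (S i)) / N} ≤
        ENNReal.ofReal δ := by
  rcases le_or_gt 1 δ with h1 | h1
  · exact prob_le_one.trans (by simpa using ENNReal.ofReal_le_ofReal h1)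
  have hN' : (0 : ℝ) < N := by exact_mod_cast hN
  set ν : Measure (Fin N → Z) := Measure.pi fun _ => D with hν
  set t := 1 / √N * (3 * b * √(Real.log (1 / δ))) with ht
  have hlog : 0 ≤ Real.log (1 / δ) := Real.log_nonneg (by rw [le_div_iff₀ hδ]; linarith)
  have hmean := integral_supDev_le hg h hN hρ
  have htail := measureReal_ge_le_of_boundedDiff D (measurable_supDev D hg)
    (abs_supDev_le hb.le h) (abs_supDev_update_sub_le h (N := N)) (t := t) (by positivity)
  have hexp : Real.exp (-t ^ 2 / (2 * (N * (2 * b / N) ^ 2))) ≤ δ := by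
    have h2 : -t ^ 2 / (2 * (N * (2 * b / N) ^ 2)) = -(9 / 8 * Real.log (1 / δ)) := by
      rw [ht, mul_pow, mul_pow, div_pow, Real.sq_sqrt hN'.le, Real.sq_sqrt hlog]
      field_simp
      ring
    rw [h2, ← Real.exp_log hδ, Real.exp_le_exp, Real.exp_log hδ]
    rw [one_div, Real.log_inv] at hlog ⊢
    linarith
  rw [ENNReal.le_ofReal_iff_toReal_le (measure_ne_top _ _) hδ.le]
  refine le_trans (measureReal_mono ?_) (htail.trans hexp)
  rintro S ⟨f, hf⟩
  have := Finset.le_sup' (fun f => ∫ z, g f z ∂D - (∑ i, g f (S i)) / N) (Finset.mem_univ f)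
  change t ≤ supDev D g S - _
  unfold supDev at *
  linarith

end Symmetrization

/-! ### The generalization bound -/

section Regularity

variable {a d M T : ℕ}

instance matrixSecondCountable {m n : ℕ} :
    SecondCountableTopology (Matrix (Fin m) (Fin n) ℝ) :=
  inferInstanceAs (SecondCountableTopology (Fin m → Fin n → ℝ))

instance matrixMetrizable {m n : ℕ} :
    TopologicalSpace.MetrizableSpace (Matrix (Fin m) (Fin n) ℝ) :=
  inferInstanceAs (TopologicalSpace.MetrizableSpace (Fin m → Fin n → ℝ))

instance matrixBorel {m n : ℕ} : BorelSpace (Matrix (Fin m) (Fin n) ℝ) :=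
  inferInstanceAs (BorelSpace (Fin m → Fin n → ℝ))

lemma l2Norm_nonneg {n : ℕ} (v : Fin n → ℝ) : 0 ≤ l2Norm v := norm_nonneg _

lemma norm21_nonneg {m n : ℕ} (A : Matrix (Fin m) (Fin n) ℝ) : 0 ≤ norm21 A :=
  Finset.sum_nonneg fun _ _ => l2Norm_nonneg _

lemma norm2inf_le_norm21 {m n : ℕ} (A : Matrix (Fin m) (Fin n) ℝ) : norm2inf A ≤ norm21 A :=
  Real.iSup_le (fun j => Finset.single_le_sum (f := fun j => l2Norm fun i => A i j)
    (fun _ _ => l2Norm_nonneg _) (Finset.mem_univ j)) (norm21_nonneg A)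

lemma continuous_norm21 {m n : ℕ} : Continuous (norm21 : Matrix (Fin m) (Fin n) ℝ → ℝ) := by
  refine continuous_finsetSum _ fun j _ => ?_
  refine continuous_norm.comp ((PiLp.continuous_toLp 2 _).comp ?_)
  exact continuous_pi fun i => continuous_id.matrix_elem i j

/-- A function that is Lipschitz for `‖·‖_{2,∞}` is continuous. -/
lemma continuous_of_le_norm2inf {m n : ℕ} {φ : Matrix (Fin m) (Fin n) ℝ → ℝ} {L : ℝ} (hL : 0 ≤ L)
    (h : ∀ A A', |φ A - φ A'| ≤ L * norm2inf (A - A')) : Continuous φ := by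
  refine continuous_iff_continuousAt.2 fun A => ?_
  refine tendsto_iff_dist_tendsto_zero.2 ?_
  have hlim : Filter.Tendsto (fun A' => L * norm21 (A' - A)) (nhds A) (nhds 0) := by
    have : Continuous fun A' => L * norm21 (A' - A) :=
      continuous_const.mul (continuous_norm21.comp (continuous_id.sub continuous_const))
    have h0 := this.tendsto A
    simpa [norm21, l2Norm, ← Pi.zero_def] using h0
  refine squeeze_zero (fun _ => dist_nonneg) (fun A' => ?_) hlim
  rw [Real.dist_eq]
  exact (h A' A).trans (mul_le_mul_of_nonneg_left (norm2inf_le_norm21 _) hL)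

/-- The layer depends continuously on the weights and the input. -/
lemma continuous_fHop (β : ℝ) : Continuous fun p : (Matrix (Fin a) (Fin d) ℝ ×
    Matrix (Fin a) (Fin d) ℝ) × Input a d M T => fHop β p.1.1 p.1.2 p.2 := by
  unfold fHop
  refine Continuous.matrix_mul (by fun_prop) ?_
  have hz : Continuous fun p : (Matrix (Fin a) (Fin d) ℝ × Matrix (Fin a) (Fin d) ℝ) ×
      Input a d M T => β • (p.2.1 * p.1.1 * p.2.2ᵀ) := by fun_prop
  refine continuous_matrix fun μ τ => ?_
  simp only [softmax1Cols, Matrix.of_apply, softmax1]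
  have he : ∀ ν, Continuous fun p : (Matrix (Fin a) (Fin d) ℝ × Matrix (Fin a) (Fin d) ℝ) ×
      Input a d M T => Real.exp ((β • (p.2.1 * p.1.1 * p.2.2ᵀ)) ν τ) := fun ν =>
    Real.continuous_exp.comp (hz.matrix_elem ν τ)
  refine (he μ).div ((continuous_finsetSum _ fun ν _ => he ν).add continuous_const) fun p => ?_
  positivity

variable {U : Type*} [MeasurableSpace U] {ℓ : Matrix (Fin d) (Fin T) ℝ → U → ℝ} {L b : ℝ}

lemma measurable_fHop (β : ℝ) (WK WV : Matrix (Fin a) (Fin d) ℝ) :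
    Measurable fun x : Input a d M T => fHop β WK WV x := by
  have h : Continuous fun x : Input a d M T => ((WK, WV), x) :=
    continuous_const.prodMk continuous_id
  exact ((continuous_fHop β).comp h).measurable

lemma measurable_uncurry_loss (hL : 0 ≤ L) (hm : ∀ A, Measurable (ℓ A))
    (hlip : ∀ A A' u, |ℓ A u - ℓ A' u| ≤ L * norm2inf (A - A')) :
    Measurable fun p : Matrix (Fin d) (Fin T) ℝ × U => ℓ p.1 p.2 :=
  measurable_uncurry_of_continuous_of_measurable (u := ℓ)
    (fun u => continuous_of_le_norm2inf hL fun A A' => hlip A A' u) hm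

lemma measurable_loss_fHop (hL : 0 ≤ L) (hm : ∀ A, Measurable (ℓ A))
    (hlip : ∀ A A' u, |ℓ A u - ℓ A' u| ≤ L * norm2inf (A - A')) (β : ℝ)
    (WK WV : Matrix (Fin a) (Fin d) ℝ) :
    Measurable fun z : Input a d M T × U => ℓ (fHop β WK WV z.1) z.2 :=
  (measurable_uncurry_loss hL hm hlip).comp
    (((measurable_fHop β WK WV).comp measurable_fst).prodMk measurable_snd)

/-- For a fixed sample, the generalization gap depends continuously on the weights. -/
lemma continuous_genGap_fHop (hL : 0 ≤ L) (hm : ∀ A, Measurable (ℓ A))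
    (hlip : ∀ A A' u, |ℓ A u - ℓ A' u| ≤ L * norm2inf (A - A')) (hb : ∀ A u, |ℓ A u| ≤ b)
    (D : Measure (Input a d M T × U)) [IsProbabilityMeasure D] (β : ℝ) {N : ℕ}
    (S : Fin N → Input a d M T × U) :
    Continuous fun p : Matrix (Fin a) (Fin d) ℝ × Matrix (Fin a) (Fin d) ℝ =>
      genGap D ℓ (fHop β p.1 p.2) S := by
  have hc : ∀ z : Input a d M T × U, Continuous fun p : Matrix (Fin a) (Fin d) ℝ ×
      Matrix (Fin a) (Fin d) ℝ => ℓ (fHop β p.1 p.2 z.1) z.2 := fun z =>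
    (continuous_of_le_norm2inf hL fun A A' => hlip A A' z.2).comp
      ((continuous_fHop β).comp (continuous_id.prodMk continuous_const))
  refine Continuous.sub ?_ ((continuous_finsetSum _ fun i _ => hc (S i)).div_const _)
  exact continuous_of_dominated
    (fun p => (measurable_loss_fHop hL hm hlip β p.1 p.2).aestronglyMeasurable)
    (fun p => Filter.Eventually.of_forall fun z => hb _ _) (integrable_const b)
    (Filter.Eventually.of_forall hc)

end Regularity

/-- A bound that holds uniformly for all finite families of parameters extends to a separable
parameter space on which the process has continuous paths. -/
lemma measure_exists_lt_le_of_finite {Ω Θ : Type*} [MeasurableSpace Ω] [TopologicalSpace Θ]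
    [TopologicalSpace.SeparableSpace Θ] {μ : Measure Ω} {G : Θ → Ω → ℝ} {t : ℝ}
    (hG : ∀ ω, Continuous fun θ => G θ ω) {c : ENNReal}
    (h : ∀ (n : ℕ) (φ : Fin (n + 1) → Θ), μ {ω | ∃ i, t < G (φ i) ω} ≤ c) :
    μ {ω | ∃ θ, t < G θ ω} ≤ c := by
  rcases isEmpty_or_nonempty Θ with hΘ | hΘ
  · simp
  let u := TopologicalSpace.denseSeq Θ
  let s : ℕ → Set Ω := fun n => {ω | ∃ i : Fin (n + 1), t < G (u i) ω}
  have hs : Monotone s := by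
    rintro m n hmn ω ⟨i, hi⟩
    exact ⟨⟨i, by omega⟩, hi⟩
  have hsub : {ω | ∃ θ, t < G θ ω} ⊆ ⋃ n, s n := by
    rintro ω hω
    obtain ⟨n, hθ⟩ := (TopologicalSpace.denseRange_denseSeq Θ).exists_mem_open
      (isOpen_lt continuous_const (hG ω)) hω
    exact Set.mem_iUnion.2 ⟨n, ⟨⟨n, by omega⟩, hθ⟩⟩
  refine (measure_mono hsub).trans ?_
  rw [hs.measure_iUnion]
  exact iSup_le fun n => h n fun i => u i

section Assembly

open scoped BigOperators

variable {a d M T N : ℕ} {U : Type*} {ℓ : Matrix (Fin d) (Fin T) ℝ → U → ℝ}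
  {β BY BK BK21 BV BV21 L : ℝ}

/-- The Rademacher averages of the layers composed with the loss, on a double sample with admissible
inputs. -/
lemma expect_signSup_loss_le {F : Type*} [Fintype F] [Nonempty F] (hsize : 2 ≤ d * N * M)
    (hL : 0 ≤ L) (hBY : 0 ≤ BY) (hBK21 : 0 ≤ BK21) (hBV : 0 ≤ BV) (hBV21 : 0 ≤ BV21)
    (hlip : ∀ A A' u, |ℓ A u - ℓ A' u| ≤ L * norm2inf (A - A'))
    (WK WV : F → Matrix (Fin a) (Fin d) ℝ) (hK : ∀ f, WK f ∈ weightClass a d BK BK21)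
    (hV : ∀ f, WV f ∈ weightClass a d BV BV21)
    (w : Fin N → (Input a d M T × U) × (Input a d M T × U))
    (hw : ∀ i, InputBounds BY (w i).1.1 ∧ InputBounds BY (w i).2.1) :
    𝔼 σ, signSup (fun f i => ℓ (fHop β (WK f) (WV f) (w i).2.1) (w i).2.2 -
        ℓ (fHop β (WK f) (WV f) (w i).1.1) (w i).1.2) σ ≤
      13 * (1 + Real.log N) * (6 * L * (BY * (BV21 + 4 * |β| * BV * BY * BK21)) *
        √(N * (2 * Real.log (1 + 4 * (d * N * M))))) := by
  classical
  have hN : 1 ≤ N := by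
    by_contra hc
    have : N = 0 := by omega
    simp [this] at hsize
  have hsize' : (2 : ℝ) ≤ d * N * M := by exact_mod_cast hsize
  set R := BY * (BV21 + 4 * |β| * BV * BY * BK21) with hR
  have hR0 : 0 ≤ R := by positivity
  -- Both halves of the double sample are covered at once, whence `2 N M` memory vectors.
  let x : Fin N ⊕ Fin N → Input a d M T := Sum.elim (fun i => (w i).1.1) (fun i => (w i).2.1)
  have hx : ∀ i, InputBounds BY (x i) := by
    rintro (i | i)
    · exact (hw i).1
    · exact (hw i).2
  choose C hC hcov using fun k => exists_fHop_cover (BK := BK) (BV := BV) (β := β) hBY hBK21 hBV21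
    x hx k
  choose p hp happ using fun k f => hcov k (WK f) (hK f) (WV f) (hV f)
  let φ : Matrix (Fin a) (Fin d) ℝ × Matrix (Fin a) (Fin d) ℝ → Fin N → ℝ := fun c i =>
    ℓ (fHop β c.1 c.2 (w i).2.1) (w i).2.2 - ℓ (fHop β c.1 c.2 (w i).1.1) (w i).1.2
  have hlog : 1 ≤ 2 * Real.log (1 + 4 * (d * N * M)) := by
    have h1 : Real.log 2 ≤ Real.log (1 + 4 * (d * N * M)) :=
      Real.log_le_log (by norm_num) (by linarith)
    have := Real.log_two_gt_d9
    linarith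
  have key := expect_signSup_le_log (a := fun k f => φ (p k f)) (ε := 6 * L * R)
    (h := fun f i => ℓ (fHop β (WK f) (WV f) (w i).2.1) (w i).2.2 -
      ℓ (fHop β (WK f) (WV f) (w i).1.1) (w i).1.2) (by positivity) hlog (by simpa using hN)
    (fun k f i => ?_) (fun k => ?_)
  · simpa using key
  · have h1 := (hlip (fHop β (WK f) (WV f) (w i).1.1) (fHop β (p k f).1 (p k f).2 (w i).1.1)
      (w i).1.2).trans (mul_le_mul_of_nonneg_left (happ k f (Sum.inl i)) hL)
    have h2 := (hlip (fHop β (WK f) (WV f) (w i).2.1) (fHop β (p k f).1 (p k f).2 (w i).2.1)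
      (w i).2.2).trans (mul_le_mul_of_nonneg_left (happ k f (Sum.inr i)) hL)
    have h3 : 6 * L * R / 2 ^ k = L * (3 * R / 2 ^ k) + L * (3 * R / 2 ^ k) := by ring
    rw [h3]
    simp only [φ]
    rw [abs_le] at h1 h2 ⊢
    constructor <;> linarith
  · have hsub : Set.range (fun f => φ (p k f)) ⊆ ((C k).image φ : Finset (Fin N → ℝ)) := by
      rintro _ ⟨f, rfl⟩
      exact Finset.mem_coe.2 (Finset.mem_image_of_mem φ (hp k f))
    have h1 : (Set.range fun f => φ (p k f)).ncard ≤ (C k).card := by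
      refine (Set.ncard_le_ncard hsub (Finset.finite_toSet _)).trans ?_
      rw [Set.ncard_coe_finset]
      exact Finset.card_image_le
    have h2 : (((Set.range fun f => φ (p k f)).ncard : ℕ) : ℝ) ≤
        ((1 + 2 * (d * ((N + N) * M))) ^ (2 * (4 ^ k - 1)) : ℕ) := by
      exact_mod_cast h1.trans (by simpa using hC k)
    refine h2.trans (le_of_eq ?_)
    have h4 : ((4 ^ k - 1 : ℕ) : ℝ) = 4 ^ k - 1 := by
      rw [Nat.cast_sub (Nat.one_le_pow _ _ (by norm_num))]
      push_cast
      ring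
    rw [Nat.cast_pow, ← Real.exp_log (x := ((1 + 2 * (d * ((N + N) * M)) : ℕ) : ℝ))
      (by positivity), ← Real.exp_nat_mul, Nat.cast_mul, h4]
    push_cast
    congr 1
    ring_nf

/-- The bound on the Rademacher averages, expressed through `E₁` and `E₂`. -/
lemma rademacher_bound_le (hsize : 2 ≤ d * N * M) (hL : 0 ≤ L) (hBY : 0 ≤ BY) (hBK21 : 0 ≤ BK21)
    (hBV : 0 ≤ BV) (hBV21 : 0 ≤ BV21) :
    13 * (1 + Real.log N) * (6 * L * (BY * (BV21 + 4 * |β| * BV * BY * BK21)) *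
        √(N * (2 * Real.log (1 + 4 * (d * N * M))))) ≤
      N * (1000 * (1 / √(N : ℝ)) * (L * BY * (1 + Real.log N) *
        √((E1 d N M β BY BK21 BV + E2 d N M BV21) ^ 3))) := by
  have hN : (1 : ℝ) ≤ N := by
    rcases Nat.eq_zero_or_pos N with h0 | h0
    · simp [h0] at hsize
    · exact_mod_cast h0
  have hsize' : (2 : ℝ) ≤ d * N * M := by exact_mod_cast hsize
  have hlogN : 0 ≤ Real.log N := Real.log_nonneg hN
  set X : ℝ := d * N * M with hX
  set l := Real.log X with hl
  have hl0 : 0 ≤ l := Real.log_nonneg (by linarith)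
  have hlog : 2 * Real.log (1 + 4 * X) ≤ 3 ^ 2 * l := by
    have h1 : 1 + 4 * X ≤ X ^ 4 := by
      have h2 : (2 : ℝ) ^ 3 ≤ X ^ 3 := by gcongr
      nlinarith
    have h2 := Real.log_le_log (by linarith) h1
    rw [Real.log_pow] at h2
    push_cast at h2
    linarith
  set P := 2 * BV * BY * |β| * BK21 * √l with hP
  set Q := BV21 * √l with hQ
  have hP0 : 0 ≤ P := by positivity
  have hQ0 : 0 ≤ Q := by positivity
  -- Up to constants, `√((E₁ + E₂)³)` is the sum `P + Q` of the roots of the cubes.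
  have hcube : ∀ x : ℝ, 0 ≤ x → (x ^ (1 / 3 : ℝ)) ^ 3 = x := by
    intro x hx
    rw [← Real.rpow_natCast, ← Real.rpow_mul hx]
    norm_num
  set e1 := E1 d N M β BY BK21 BV with he1
  set e2 := E2 d N M BV21 with he2
  have h1 : e1 ^ 3 = P ^ 2 := by
    rw [he1, E1, hcube _ (by positivity), hP]
    simp only [mul_pow, Real.sq_sqrt hl0, sq_abs]
    ring
  have h2 : e2 ^ 3 = Q ^ 2 := by
    rw [he2, E2, hcube _ (by positivity), hQ, mul_pow, Real.sq_sqrt hl0]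
  have h10 : 0 ≤ e1 := Real.rpow_nonneg (by positivity) _
  have h20 : 0 ≤ e2 := Real.rpow_nonneg (by positivity) _
  have hPQ : P + Q ≤ 2 * √((e1 + e2) ^ 3) := by
    have h3 : P ^ 2 + Q ^ 2 ≤ (e1 + e2) ^ 3 := by
      rw [← h1, ← h2]
      have : 0 ≤ 3 * e1 ^ 2 * e2 + 3 * e1 * e2 ^ 2 := by positivity
      nlinarith
    have h4 : P ≤ √((e1 + e2) ^ 3) := Real.le_sqrt_of_sq_le (by nlinarith [sq_nonneg Q])
    have h5 : Q ≤ √((e1 + e2) ^ 3) := Real.le_sqrt_of_sq_le (by nlinarith [sq_nonneg P])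
    linarith
  have hNs : (N : ℝ) * (1 / √N) = √N := by
    rw [mul_one_div, Real.div_sqrt]
  calc _ ≤ 13 * (1 + Real.log N) * (6 * L * (BY * (BV21 + 4 * |β| * BV * BY * BK21)) *
        √(N * (3 ^ 2 * l))) := by gcongr
    _ = √N * (234 * (L * BY * (1 + Real.log N)) * (Q + 2 * P)) := by
        rw [Real.sqrt_mul (by positivity), Real.sqrt_mul (by positivity),
          Real.sqrt_sq (by norm_num), hP, hQ]
        ring
    _ ≤ √N * (234 * (L * BY * (1 + Real.log N)) * (4 * √((e1 + e2) ^ 3))) := by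
        gcongr
        linarith
    _ ≤ √N * (1000 * (L * BY * (1 + Real.log N) * √((e1 + e2) ^ 3))) := by
        gcongr ?_ * ?_
        have : 0 ≤ L * BY * (1 + Real.log N) * √((e1 + e2) ^ 3) := by positivity
        linarith
    _ = (N * (1 / √N)) * (1000 * (L * BY * (1 + Real.log N) * √((e1 + e2) ^ 3))) := by rw [hNs]
    _ = _ := by ring

variable [MeasurableSpace U] {D : Measure (Input a d M T × U)} [IsProbabilityMeasure D] {b : ℝ}

/-- The one-sided bound on the generalization gap, uniformly over the class of layers. -/
theorem measure_genGap_le (hsize : 2 ≤ d * N * M) (hL : 0 ≤ L)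
    (hD : ∀ᵐ z ∂D, InputBounds BY z.1) (hm : ∀ A, Measurable (ℓ A))
    (hlip : ∀ A A' u, |ℓ A u - ℓ A' u| ≤ L * norm2inf (A - A')) (hb : ∀ A u, |ℓ A u| ≤ b)
    {δ : ℝ} (hδ : 0 < δ) :
    Measure.pi (fun _ : Fin N => D) {S | ¬ ∀ f ∈ hopClass a d M T β BK BK21 BV BV21,
      genGap D ℓ f S ≤ 1000 * (1 / √(N : ℝ)) * (L * BY * (1 + Real.log N) *
        √((E1 d N M β BY BK21 BV + E2 d N M BV21) ^ 3) + b * √(Real.log (1 / δ)))} ≤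
      ENNReal.ofReal δ := by
  have hN : 1 ≤ N := by
    rcases Nat.eq_zero_or_pos N with h0 | h0
    · simp [h0] at hsize
    · exact h0
  have hM : 0 < M := by
    rcases Nat.eq_zero_or_pos M with h0 | h0
    · simp [h0] at hsize
    · exact h0
  set t := 1000 * (1 / √(N : ℝ)) * (L * BY * (1 + Real.log N) *
    √((E1 d N M β BY BK21 BV + E2 d N M BV21) ^ 3) + b * √(Real.log (1 / δ))) with ht
  obtain ⟨z₀, hz₀⟩ := hD.exists
  have hBY : 0 ≤ BY := (l2Norm_nonneg _).trans (hz₀.2 ⟨0, hM⟩)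
  have hb0 : 0 ≤ b := (abs_nonneg _).trans (hb 0 z₀.2)
  have hlogN : 0 ≤ Real.log N := Real.log_nonneg (by exact_mod_cast hN)
  have ht0 : 0 ≤ t := by positivity
  let Θ := {p : Matrix (Fin a) (Fin d) ℝ × Matrix (Fin a) (Fin d) ℝ //
    p.1 ∈ weightClass a d BK BK21 ∧ p.2 ∈ weightClass a d BV BV21}
  have hΘ : SecondCountableTopology Θ := TopologicalSpace.Subtype.secondCountableTopology _
  have hset : {S : Fin N → Input a d M T × U | ¬ ∀ f ∈ hopClass a d M T β BK BK21 BV BV21,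
      genGap D ℓ f S ≤ t} = {S | ∃ θ : Θ, t < genGap D ℓ (fHop β θ.1.1 θ.1.2) S} := by
    ext S
    simp only [Set.mem_ofPred_eq, hopClass]
    push Not
    constructor
    · rintro ⟨_, ⟨WK, hK, WV, hV, rfl⟩, h⟩
      exact ⟨⟨(WK, WV), hK, hV⟩, h⟩
    · rintro ⟨⟨p, hK, hV⟩, h⟩
      exact ⟨_, ⟨p.1, hK, p.2, hV, rfl⟩, h⟩
  rw [hset]
  refine measure_exists_lt_le_of_finite (G := fun (θ : Θ) S => genGap D ℓ (fHop β θ.1.1 θ.1.2) S)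
    (fun S => (continuous_genGap_fHop hL hm hlip hb D β S).comp continuous_subtype_val)
    fun n φ => ?_
  -- The bounds are nonnegative because the class has a member.
  have hBK21 : 0 ≤ BK21 := (norm21_nonneg _).trans (φ 0).2.1.2
  have hBV : 0 ≤ BV := (norm_nonneg _).trans (φ 0).2.2.1
  have hBV21 : 0 ≤ BV21 := (norm21_nonneg _).trans (φ 0).2.2.2
  -- The concentration inequality divides by `b`; for `b = 0` the loss vanishes.
  rcases hb0.eq_or_lt with rfl | hbpos
  · have hzero : ∀ A u, ℓ A u = 0 := fun A u => abs_nonpos_iff.1 (hb A u)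
    have : ∀ f (S : Fin N → Input a d M T × U), genGap D ℓ f S = 0 := fun f S => by
      simp [genGap, risk, empRisk, hzero]
    simp [this, ht0.not_gt]
  have hae : ∀ᵐ w ∂(Measure.pi fun _ : Fin N => D.prod D),
      ∀ i, InputBounds BY (w i).1.1 ∧ InputBounds BY (w i).2.1 := by
    refine ae_all_iff.2 fun i => ?_
    have h1 : ∀ᵐ p ∂(D.prod D), InputBounds BY p.1.1 ∧ InputBounds BY p.2.1 :=
      (Measure.quasiMeasurePreserving_fst.ae hD).and (Measure.quasiMeasurePreserving_snd.ae hD)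
    exact (Measure.quasiMeasurePreserving_eval (μ := fun _ : Fin N => D.prod D) i).ae h1
  have hfin := measure_exists_gap_gt_le (D := D) (N := N)
    (g := fun (i : Fin (n + 1)) z => ℓ (fHop β (φ i).1.1 (φ i).1.2 z.1) z.2)
    (fun i => measurable_loss_fHop hL hm hlip β _ _) (fun i z => hb _ _) hbpos hN
    (ρ := 1000 * (1 / √(N : ℝ)) * (L * BY * (1 + Real.log N) *
      √((E1 d N M β BY BK21 BV + E2 d N M BV21) ^ 3)))
    (hae.mono fun w hw => (expect_signSup_loss_le hsize hL hBY hBK21 hBV hBV21 hlip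
      (fun i => (φ i).1.1) (fun i => (φ i).1.2) (fun i => (φ i).2.1) (fun i => (φ i).2.2)
      w hw).trans (rademacher_bound_le hsize hL hBY hBK21 hBV hBV21)) hδ
  refine (measure_mono ?_).trans hfin
  rintro S ⟨i, hi⟩
  refine ⟨i, lt_of_le_of_lt ?_ hi⟩
  have : 0 ≤ 1 / √(N : ℝ) * (b * √(Real.log (1 / δ))) := by positivity
  rw [ht, mul_add]
  linarith

end Assembly

end OutEffHop

theorem theorem3p4 :
    ∃ C : ℝ, 0 < C ∧
      ∀ (a d M T N : ℕ), 2 ≤ d * N * M →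
      ∀ (β BY BK BK21 BV BV21 L b : ℝ), 0 ≤ L →
      ∀ (U : Type*) [MeasurableSpace U]
        (D : MeasureTheory.Measure (OutEffHop.Input a d M T × U))
        [MeasureTheory.IsProbabilityMeasure D],
        (∀ᵐ z ∂D, OutEffHop.InputBounds BY z.1) →
      ∀ ℓ : Matrix (Fin d) (Fin T) ℝ → U → ℝ,
        (∀ A, Measurable (ℓ A)) →
        (∀ A A' u, |ℓ A u - ℓ A' u| ≤ L * OutEffHop.norm2inf (A - A')) →
        (∀ A u, |ℓ A u| ≤ b) →
      ∀ δ : ℝ, 0 < δ →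
        MeasureTheory.Measure.pi (fun _ : Fin N => D)
            {S | ¬ ∀ f ∈ OutEffHop.hopClass a d M T β BK BK21 BV BV21,
              OutEffHop.genGap D ℓ f S ≤
                C * (1 / √(N : ℝ)) *
                  (L * BY * (1 + Real.log N) *
                      √((OutEffHop.E1 d N M β BY BK21 BV + OutEffHop.E2 d N M BV21) ^ 3) +
                    b * √(Real.log (1 / δ)))} ≤ ENNReal.ofReal δ ∧
        MeasureTheory.Measure.pi (fun _ : Fin N => D)
            {S | ¬ ∀ f ∈ OutEffHop.hopClass a d M T β BK BK21 BV BV21,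
              OutEffHop.genError D ℓ f S ≤
                C * (1 / √(N : ℝ)) *
                  (L * BY * (1 + Real.log N) *
                      √((OutEffHop.E1 d N M β BY BK21 BV + OutEffHop.E2 d N M BV21) ^ 3) +
                    b * √(Real.log (2 / δ)))} ≤ ENNReal.ofReal δ := by
  refine ⟨1000, by norm_num, ?_⟩
  intro a d M T N hsize β BY BK BK21 BV BV21 L b hL U _ D _ hD ℓ hm hlip hb δ hδ
  refine ⟨OutEffHop.measure_genGap_le hsize hL hD hm hlip hb hδ, ?_⟩
  have hδ2 : 0 < δ / 2 := by positivity
  have hlog : Real.log (2 / δ) = Real.log (1 / (δ / 2)) := by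
    congr 1
    field_simp
  rw [hlog]
  have h1 := OutEffHop.measure_genGap_le (N := N) (β := β) (BK := BK) (BK21 := BK21) (BV := BV)
    (BV21 := BV21) hsize hL hD hm hlip hb hδ2
  have h2 := OutEffHop.measure_genGap_le (N := N) (β := β) (BK := BK) (BK21 := BK21) (BV := BV)
    (BV21 := BV21) (ℓ := fun A u => -ℓ A u) hsize hL hD (fun A => (hm A).neg)
    (fun A A' u => by
      rw [neg_sub_neg, abs_sub_comm]
      exact hlip A A' u)
    (fun A u => by rw [abs_neg]; exact hb A u) hδ2
  have hneg : ∀ f S, OutEffHop.genGap (N := N) D (fun A u => -ℓ A u) f S =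
      -OutEffHop.genGap D ℓ f S := by
    intro f S
    simp only [OutEffHop.genGap, OutEffHop.risk, OutEffHop.empRisk,
      MeasureTheory.integral_neg, Finset.sum_neg_distrib]
    ring
  simp only [hneg] at h2
  calc _ ≤ _ := MeasureTheory.measure_mono ?_
    _ ≤ _ := MeasureTheory.measure_union_le _ _
    _ ≤ ENNReal.ofReal (δ / 2) + ENNReal.ofReal (δ / 2) := add_le_add h1 h2
    _ = ENNReal.ofReal δ := by
      rw [← ENNReal.ofReal_add hδ2.le hδ2.le, add_halves]
  intro S hS
  by_contra hc
  simp only [Set.mem_union, Set.mem_ofPred_eq, not_or, not_not] at hc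
  exact hS fun f hf => abs_le.2 ⟨by linarith [hc.2 f hf], hc.1 f hf⟩
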